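/- Let $\Gamma=\langle a,b : a^2=b^2=e\rangle$ be the infinite dihedral group and $\mathbf X=\{0,1\}$. Let $\Gamma$ act faithfully on the rooted tree $\mathbf X^*$ of finite words by $a\cdot(0w)=1w$, $a\cdot(1w)=0w$, $b\cdot(0w)=0(a\cdot w)$, $b\cdot(1w)=1(b\cdot w)$, and let $\Gamma$ act correspondingly by homeomorphisms on the space $\mathbf X^\infty$ of infinite words (product topology). For $\alpha,\beta\in\mathbf X^*$ and $g\in\Gamma$ let $Z(\beta)=\{\beta x: x\in\mathbf X^\infty\}$ and let $S_{(\alpha,g,\beta)}:Z(\beta)\to Z(\alpha)$ be the homeomorphism $\beta x\mapsto \alpha(g\cdot x)$. Let $$\mathcal H=\mathcal H_{(\Gamma,\mathbf X)}=\{[\alpha,g,\beta;x] : |\alpha|=|\beta|,\ g\in\Gamma,\ x\in Z(\beta)\}$$ be the groupoid of germs $[\alpha,g,\beta;x]$ of the maps $S_{(\alpha,g,\beta)}$ with $|\alpha|=|\beta|$ at points $x\in Z(\beta)$, where germs are multiplied by composing maps, the source of $[\alpha,g,\beta;x]$ is $x$ and its range is $S_{(\alpha,g,\beta)}(x)$,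 and the sets $\{[\alpha,g,\beta;x]:x\in U\}$ with $U\subseteq Z(\beta)$ open form a basis of the topology. (It is the kernel of the cocycle $[\alpha,g,\beta;x]\mapsto|\alpha|-|\beta|$ on the groupoid of germs of all the maps $S_{(\alpha,g,\beta)}$.) It is an effective Hausdorff ample groupoid with compact unit space $\mathbf X^\infty$. For an effective Hausdorff ample groupoid $\mathcal G$ with compact unit space and with source and range maps $s,r$, let $H_1(\mathcal G)=\ker\delta_1/\operatorname{im}\delta_2$, where $\delta_1=s_*-r_*:C_c(\mathcal G,\mathbb Z)\to C_c(\mathcal G^{(0)},\mathbb Z)$, $\delta_2=d_{0*}-d_{1*}+d_{2*}:C_c(\mathcal G^{(2)},\mathbb Z)\to C_c(\mathcal G,\mathbb Z)$, $\mathcal G^{(2)}$ is the space of composable pairs, $d_0(g,h)=h$, $d_1(g,h)=gh$, $d_2(g,h)=g$, and $\pi_*f(y)=\sum_{\pi(x)=y}f(x)$. A bisection is an open set $U\subseteq\mathcal G$ on which $s$ and $r$ are homeomorphisms onto their images, and it is full if $s(U)=r(U)=\mathcal G^{(0)}$. For a full bisection $U$ let $\pi_U$ be the homeomorphism $s(\gamma)\mapsto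 r(\gamma)$ $(\gamma\in U)$ of $\mathcal G^{(0)}$, let $[[\mathcal G]]$ be the group of all such $\pi_U$ under composition, and let the index map $I:[[\mathcal G]]\to H_1(\mathcal G)$ be the homomorphism $\pi_U\mapsto[1_U]$. A transposition is an element $\pi_{\hat U}$ where $U$ is a compact bisection with $r(U)\cap s(U)=\emptyset$ and $\hat U=U\sqcup U^{-1}\sqcup(\mathcal G^{(0)}\setminus(r(U)\cup s(U)))$. Let $\mathcal T(\mathcal G)$ be the subgroup of $[[\mathcal G]]$ generated by all transpositions. The groupoid $\mathcal G$ has Property TR if $\mathcal T(\mathcal G)=\ker I$. **Proposition.** The groupoid $\mathcal H_{(\Gamma,\mathbf X)}$ has Property TR, that is, $\mathcal T(\mathcal H_{(\Gamma,\mathbf X)})=\ker\bigl(I:[[\mathcal H_{(\Gamma,\mathbf X)}]]\to H_1(\mathcal H_{(\Gamma,\mathbf X)})\bigr)$. -/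

import Mathlib

namespace TRGroupoid

open Set Filter Topology CompactlySupported

/-! ### Push-forward of compactly supported integer-valued functions -/

section Pushforward

variable {X Y : Type*} [TopologicalSpace X] [TopologicalSpace Y]

theorem isLocalHomeomorph_of_isOpenMap {f : X → Y} (hc : Continuous f) (ho : IsOpenMap f)
    (hi : ∀ x, ∃ U, IsOpen U ∧ x ∈ U ∧ InjOn f U) : IsLocalHomeomorph f := by
  rw [isLocalHomeomorph_iff_isOpenEmbedding_restrict]
  intro x
  obtain ⟨U, hU, hx, hinj⟩ := hi x
  refine ⟨U, hU.mem_nhds hx, ?_⟩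
  exact IsOpenEmbedding.of_continuous_injective_isOpenMap
    (hc.comp continuous_subtype_val) (injOn_iff_injective.1 hinj)
    (ho.comp hU.isOpenMap_subtype_val)

theorem fiber_finite [T2Space X] [T2Space Y] {p : X → Y} (hp : IsLocalHomeomorph p)
    {K : Set X} (hK : IsCompact K) (y : Y) : (K ∩ p ⁻¹' {y}).Finite := by
  have hc : IsCompact (K ∩ p ⁻¹' {y}) :=
    hK.inter_right (isClosed_singleton.preimage hp.continuous)
  by_contra hinf
  obtain ⟨x, hx, hacc⟩ := Set.Infinite.exists_accPt_of_subset_isCompact hinf hc subset_rfl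
  obtain ⟨U, hU, hxU, hinj⟩ := hp.isLocallyInjective x
  rw [accPt_iff_nhds] at hacc
  obtain ⟨z, hz, hne⟩ := hacc U (hU.mem_nhds hxU)
  exact hne (hinj hz.1 hxU (by rw [hz.2.2, hx.2]))

theorem fiber_support_finite [T2Space X] [T2Space Y] {p : X → Y} (hp : IsLocalHomeomorph p)
    (f : C_c(X, ℤ)) (y : Y) : (p ⁻¹' {y} ∩ Function.support f).Finite :=
  (fiber_finite hp f.hasCompactSupport y).subset
    fun _ hx => ⟨subset_tsupport _ hx.2, hx.1⟩

theorem pushforward_eventually_const [T2Space X] [T2Space Y] {p : X → Y}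
    (hp : IsLocalHomeomorph p) (f : C_c(X, ℤ)) (y₀ : Y) :
    ∀ᶠ y in 𝓝 y₀, (∑ᶠ x ∈ p ⁻¹' {y}, f x) = ∑ᶠ x ∈ p ⁻¹' {y₀}, f x := by
  classical
  set K := tsupport f with hK
  have hKc : IsCompact K := f.hasCompactSupport
  set F := K ∩ p ⁻¹' {y₀} with hF
  have hfin : F.Finite := fiber_finite hp hKc y₀
  obtain ⟨U, hU, hdisj⟩ := hfin.t2_separation
  have hW : ∀ x : X, ∃ W : Set X, IsOpen W ∧ x ∈ W ∧ W ⊆ U x ∧ InjOn p W ∧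
      ∀ z ∈ W, f z = f x := by
    intro x
    obtain ⟨V, hV, hxV, hinj⟩ := hp.isLocallyInjective x
    have ho : IsOpen (f ⁻¹' {f x}) := (isOpen_discrete _).preimage f.continuous
    exact ⟨U x ∩ V ∩ f ⁻¹' {f x}, ((hU x).2.inter hV).inter ho, ⟨⟨(hU x).1, hxV⟩, rfl⟩,
      fun z hz => hz.1.1, hinj.mono fun z hz => hz.1.2, fun z hz => hz.2⟩
  choose W hWo hxW hWU hWinj hWf using hW
  have hopen : IsOpen (⋃ x ∈ F, W x) := isOpen_biUnion fun x _ => hWo x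
  have hC : IsClosed (p '' (K \ ⋃ x ∈ F, W x)) :=
    ((hKc.diff hopen).image hp.continuous).isClosed
  have hy₀ : y₀ ∉ p '' (K \ ⋃ x ∈ F, W x) := by
    rintro ⟨x, ⟨hxK, hx⟩, rfl⟩
    exact hx (mem_biUnion (show x ∈ F from ⟨hxK, rfl⟩) (hxW x))
  have h1 : ∀ᶠ y in 𝓝 y₀, y ∉ p '' (K \ ⋃ x ∈ F, W x) := hC.isOpen_compl.mem_nhds hy₀
  have h2 : ∀ᶠ y in 𝓝 y₀, ∀ x ∈ F, y ∈ p '' W x := by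
    rw [hfin.eventually_all]
    intro x hx
    exact (hp.isOpenMap _ (hWo x)).mem_nhds ⟨x, hxW x, hx.2⟩
  have key : ∀ y, y ∉ p '' (K \ ⋃ x ∈ F, W x) → (∀ x ∈ F, y ∈ p '' W x) →
      (∑ᶠ x ∈ p ⁻¹' {y}, f x) = ∑ᶠ x ∈ F, f x := by
    intro y hy1 hy2
    choose! u hu using hy2
    have e1 : (∑ᶠ x ∈ p ⁻¹' {y}, f x) = ∑ᶠ x ∈ u '' F, f x := by
      apply finsum_mem_inter_support_eq
      apply subset_antisymm
      · rintro x ⟨hx, hs⟩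
        refine ⟨?_, hs⟩
        have hxK : x ∈ K := subset_tsupport _ hs
        have : x ∈ ⋃ x ∈ F, W x := by
          by_contra hn
          exact hy1 ⟨x, ⟨hxK, hn⟩, hx⟩
        obtain ⟨z, hz, hxz⟩ := mem_iUnion₂.1 this
        exact ⟨z, hz, hWinj z (hu z hz).1 hxz (by rw [(hu z hz).2]; exact hx.symm)⟩
      · rintro x ⟨⟨z, hz, rfl⟩, hs⟩
        exact ⟨(hu z hz).2, hs⟩
    rw [e1, finsum_mem_image]
    · exact finsum_mem_congr rfl fun x hx => hWf x _ (hu x hx).1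
    · intro x hx z hz hxz
      by_contra hne
      exact (Set.disjoint_left.1 (hdisj hx hz hne)) (hWU x (hu x hx).1)
        (by rw [hxz]; exact hWU z (hu z hz).1)
  have hk0 : ∀ x ∈ F, y₀ ∈ p '' W x := fun x hx => ⟨x, hxW x, hx.2⟩
  filter_upwards [h1, h2] with y hy1 hy2
  rw [key y hy1 hy2, key y₀ hy₀ hk0]

/-- For a local homeomorphism `p : X → Y` of Hausdorff spaces, the homomorphism
`p_* : C_c(X, ℤ) → C_c(Y, ℤ)` with `p_* f y = ∑_{p x = y} f x`. -/
noncomputable def pushforward [T2Space X] [T2Space Y] (p : X → Y) (hp : IsLocalHomeomorph p) :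
    C_c(X, ℤ) →+ C_c(Y, ℤ) where
  toFun f :=
    { toFun := fun y => ∑ᶠ x ∈ p ⁻¹' {y}, f x
      continuous_toFun := continuous_iff_continuousAt.2 fun y₀ =>
        continuousAt_const.congr
          ((pushforward_eventually_const hp f y₀).mono fun _ h => h.symm)
      hasCompactSupport' := by
        refine HasCompactSupport.intro
          (IsCompact.image f.hasCompactSupport hp.continuous) fun y hy => ?_
        refine finsum_mem_eq_zero_of_forall_eq_zero fun x hx => ?_
        by_contra hne
        exact hy ⟨x, subset_tsupport _ hne, hx⟩ }
  map_zero' := by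
    ext y
    simp
  map_add' f g := by
    ext y
    exact finsum_mem_add_distrib' (fiber_support_finite hp f y) (fiber_support_finite hp g y)

theorem pushforward_apply [T2Space X] [T2Space Y] (p : X → Y) (hp : IsLocalHomeomorph p)
    (f : C_c(X, ℤ)) (y : Y) : pushforward p hp f y = ∑ᶠ x ∈ p ⁻¹' {y}, f x := rfl

/-- The indicator function `1_U ∈ C_c(X, ℤ)` of a compact open set `U`. -/
noncomputable def indicatorCc [T2Space X] (U : Set X) (hU : IsOpen U) (hc : IsCompact U) :
    C_c(X, ℤ) where
  toFun := U.indicator fun _ => 1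
  continuous_toFun := IsClopen.continuous_indicator ⟨hc.isClosed, hU⟩ continuous_const
  hasCompactSupport' := HasCompactSupport.intro hc fun _ hx => indicator_of_notMem hx _

/-- If `p` maps `U` injectively, then `p_* 1_U` is the indicator of `p(U)`. -/
theorem pushforward_indicator_apply [T2Space X] [T2Space Y] (p : X → Y)
    (hp : IsLocalHomeomorph p) (U : Set X) (hU : IsOpen U) (hc : IsCompact U)
    (hi : InjOn p U) (y : Y) :
    pushforward p hp (indicatorCc U hU hc) y = (p '' U).indicator (fun _ => 1) y := by
  rw [pushforward_apply]
  change (∑ᶠ x ∈ p ⁻¹' {y}, U.indicator (fun _ => (1 : ℤ)) x) = _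
  by_cases hy : y ∈ p '' U
  · obtain ⟨x, hx, rfl⟩ := hy
    rw [indicator_of_mem (mem_image_of_mem p hx)]
    have : (∑ᶠ z ∈ p ⁻¹' {p x}, U.indicator (fun _ => (1 : ℤ)) z)
        = ∑ᶠ z ∈ ({x} : Set X), U.indicator (fun _ => (1 : ℤ)) z := by
      apply finsum_mem_inter_support_eq
      ext z
      simp only [mem_inter_iff, mem_preimage, mem_singleton_iff, Function.mem_support, ne_eq]
      constructor
      · rintro ⟨h1, h2⟩
        exact ⟨hi (mem_of_indicator_ne_zero h2) hx h1, h2⟩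
      · rintro ⟨rfl, h2⟩
        exact ⟨rfl, h2⟩
    rw [this, finsum_mem_singleton, indicator_of_mem hx]
  · rw [indicator_of_notMem hy]
    refine finsum_mem_eq_zero_of_forall_eq_zero fun x hx => ?_
    refine indicator_of_notMem (fun hxU => hy ⟨x, hxU, hx⟩) _

end Pushforward

/-! ### Topological groupoids -/

/-- A topological groupoid with arrow space `G` and unit space `X`. The product `mul g h` is
defined when the source of `g` equals the range of `h`; the unit space is kept as a separate space
`X`, identified with the set of units of `G` through the embedding `one`. -/
class TopGroupoid (G : Type*) (X : outParam (Type*)) [TopologicalSpace G]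
    [TopologicalSpace X] where
  s : G → X
  r : G → X
  one : X → G
  inv : G → G
  mul : (g h : G) → s g = r h → G
  s_one : ∀ x, s (one x) = x
  r_one : ∀ x, r (one x) = x
  s_inv : ∀ g, s (inv g) = r g
  r_inv : ∀ g, r (inv g) = s g
  s_mul : ∀ g h hgh, s (mul g h hgh) = s h
  r_mul : ∀ g h hgh, r (mul g h hgh) = r g
  one_mul : ∀ g x (h : s (one x) = r g), mul (one x) g h = g
  mul_one : ∀ g x (h : s g = r (one x)), mul g (one x) h = g
  inv_mul : ∀ g h, mul (inv g) g h = one (s g)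
  mul_inv : ∀ g h, mul g (inv g) h = one (r g)
  mul_assoc : ∀ g h k (hgh : s g = r h) (hhk : s h = r k),
    mul (mul g h hgh) k ((s_mul g h hgh).trans hhk) =
      mul g (mul h k hhk) (hgh.trans (r_mul h k hhk).symm)
  continuous_s : Continuous s
  continuous_r : Continuous r
  continuous_one : Continuous one
  continuous_inv : Continuous inv
  continuous_mul : Continuous fun p : {p : G × G // s p.1 = r p.2} => mul p.1.1 p.1.2 p.2

section Groupoid

open TopGroupoid

variable (G : Type*) {X : Type*} [TopologicalSpace G] [TopologicalSpace X] [TopGroupoid G X]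

/-- A groupoid is ample if it is étale (source and range are local homeomorphisms) and its unit
space has a basis of compact open sets. -/
class IsAmple : Prop where
  isLocalHomeomorph_s : IsLocalHomeomorph (s : G → X)
  isLocalHomeomorph_r : IsLocalHomeomorph (r : G → X)
  exists_basis : ∃ B : Set (Set X), TopologicalSpace.IsTopologicalBasis B ∧ ∀ U ∈ B, IsCompact U

/-- A groupoid is effective if the interior of its isotropy is the set of units. -/
class IsEffective : Prop where
  interior_iso : interior {g : G | r g = s g} = range (one : X → G)

/-- The space `G⁽²⁾` of composable pairs. -/
abbrev Composable : Type _ := {p : G × G // (s p.1 : X) = r p.2}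

variable {G}

theorem mul_congr {a b a' b' : G} (ha : a = a') (hb : b = b') (h : s a = r b) :
    mul a b h = mul a' b' (by rw [← ha, ← hb, h]) := by
  subst ha hb; rfl

theorem inv_mul_cancel_left (g h : G) (hgh : s g = r h) :
    mul (inv g) (mul g h hgh) (by rw [s_inv, r_mul]) = h := by
  rw [← mul_assoc _ _ _ (s_inv g) hgh, mul_congr (inv_mul _ _) rfl]
  exact one_mul _ _ _

theorem eq_of_mul_inv_eq_one {g k : G} {x : X} (h : s g = r (inv k))
    (he : mul g (inv k) h = one x) : g = k := by
  have hs : s g = s k := by rw [h, r_inv]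
  have h1 : mul (mul g (inv k) h) k (by rw [s_mul, s_inv]) = g := by
    rw [mul_assoc _ _ _ h (s_inv k), mul_congr rfl (inv_mul _ _)]
    exact mul_one _ _ _
  rw [← h1, mul_congr he rfl]
  exact one_mul _ _ _

theorem inv_inv' (g : G) : inv (inv g) = g := by
  apply eq_of_mul_inv_eq_one (x := r g) (h := by rw [s_inv])
  rw [inv_mul, s_inv]

theorem eq_inv_of_mul_eq {g k : G} {x : X} (h : s g = r k) (he : mul g k h = one x) :
    g = inv k := by
  apply eq_of_mul_inv_eq_one (x := x) (h := by rw [h, inv_inv'])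
  rw [← he]
  exact mul_congr rfl (inv_inv' k) _

/-! ### Homology in degree one -/

theorem isLocalHomeomorph_snd [IsAmple G] :
    IsLocalHomeomorph fun p : Composable G => p.1.2 := by
  refine isLocalHomeomorph_of_isOpenMap (continuous_snd.comp continuous_subtype_val) ?_ ?_
  · refine IsOpenMap.of_nhds_le fun p => ?_
    intro N hN
    rw [mem_map, nhds_induced, mem_comap] at hN
    obtain ⟨M, hM, hMN⟩ := hN
    obtain ⟨A, hA, B, hB, hAB⟩ := mem_nhds_prod_iff.1 hM
    have h1 : s '' A ∈ 𝓝 (r p.1.2) := by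
      rw [← p.2]
      exact (IsAmple.isLocalHomeomorph_s (G := G) (X := X)).isOpenMap.image_mem_nhds hA
    filter_upwards [hB, continuous_r.continuousAt.preimage_mem_nhds h1] with h hhB hh
    obtain ⟨a, ha, hah⟩ := hh
    exact hMN (show (⟨(a, h), hah⟩ : Composable G) ∈ _ from hAB ⟨ha, hhB⟩)
  · intro p
    obtain ⟨U, hU, hp, hinj⟩ := (IsAmple.isLocalHomeomorph_s (G := G) (X := X)).isLocallyInjective p.1.1
    refine ⟨(fun q : Composable G => q.1.1) ⁻¹' U,
      hU.preimage (continuous_fst.comp continuous_subtype_val), hp, ?_⟩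
    intro a ha b hb hab
    apply Subtype.ext
    refine Prod.ext (hinj ha hb ?_) hab
    rw [a.2, b.2]
    exact congrArg r hab

theorem isLocalHomeomorph_fst [IsAmple G] :
    IsLocalHomeomorph fun p : Composable G => p.1.1 := by
  refine IsLocalHomeomorph.of_comp (g := (s : G → X)) ?_ IsAmple.isLocalHomeomorph_s
    (continuous_fst.comp continuous_subtype_val)
  have h := (IsAmple.isLocalHomeomorph_r (G := G) (X := X)).comp (isLocalHomeomorph_snd (G := G) (X := X))
  convert h using 1
  ext p
  exact p.2

theorem isLocalHomeomorph_mul [IsAmple G] :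
    IsLocalHomeomorph fun p : Composable G => mul p.1.1 p.1.2 p.2 := by
  refine IsLocalHomeomorph.of_comp (g := (s : G → X)) ?_ IsAmple.isLocalHomeomorph_s
    continuous_mul
  have h := (IsAmple.isLocalHomeomorph_s (G := G) (X := X)).comp (isLocalHomeomorph_snd (G := G) (X := X))
  convert h using 1
  ext p
  exact s_mul _ _ _

theorem isOpen_range_one [IsAmple G] : IsOpen (range (one : X → G)) := by
  rw [isOpen_iff_mem_nhds]
  rintro _ ⟨x, rfl⟩
  obtain ⟨U, hU, hxU, hinj⟩ := (IsAmple.isLocalHomeomorph_s (G := G) (X := X)).isLocallyInjective (one x)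
  have hc : Continuous fun g : G => (one (s g) : G) := continuous_one.comp continuous_s
  filter_upwards [hU.mem_nhds hxU,
    hc.continuousAt.preimage_mem_nhds (hU.mem_nhds (by rwa [s_one]))] with g h1 h2
  exact ⟨s g, hinj h2 h1 (s_one _)⟩

variable (G)

section Homology

variable [IsAmple G] [T2Space G] [T2Space X]

/-- `δ₁ = s_* - r_*`. -/
noncomputable def delta₁ : C_c(G, ℤ) →+ C_c(X, ℤ) :=
  pushforward s IsAmple.isLocalHomeomorph_s - pushforward r IsAmple.isLocalHomeomorph_r

/-- `δ₂ = d₀_* - d₁_* + d₂_*`, where `d₀ (g, h) = h`, `d₁ (g, h) = g h` and `d₂ (g, h) = g`. -/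
noncomputable def delta₂ : C_c(Composable G, ℤ) →+ C_c(G, ℤ) :=
  pushforward (fun p => p.1.2) isLocalHomeomorph_snd
    - pushforward (fun p => mul p.1.1 p.1.2 p.2) isLocalHomeomorph_mul
    + pushforward (fun p => p.1.1) isLocalHomeomorph_fst

/-- The first homology group `H₁(G) = ker δ₁ / im δ₂`. -/
abbrev H₁ : Type _ :=
  (delta₁ G).ker ⧸ (delta₂ G).range.addSubgroupOf (delta₁ G).ker

end Homology

variable {G}

/-! ### Bisections and the topological full group -/

/-- A bisection of an étale groupoid: an open set on which source and range are injective (hence,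
being local homeomorphisms, homeomorphisms onto their open images). -/
structure IsBisection (U : Set G) : Prop where
  isOpen : IsOpen U
  injOn_s : InjOn s U
  injOn_r : InjOn r U

/-- A bisection is full if `s(U) = r(U) = G⁽⁰⁾`. -/
structure IsFullBisection (U : Set G) : Prop extends IsBisection U where
  image_s : s '' U = univ
  image_r : r '' U = univ

/-- The product `U V` of sets of arrows. -/
def setMul (U V : Set G) : Set G := {g | ∃ a ∈ U, ∃ b ∈ V, ∃ h : s a = r b, mul a b h = g}

/-- The set `U × V ∩ G⁽²⁾`. -/
def setPair (U V : Set G) : Set (Composable G) := {p | p.1.1 ∈ U ∧ p.1.2 ∈ V}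

/-- `h = π_U`, the homeomorphism of the unit space that maps `s(γ)` to `r(γ)` for `γ ∈ U`. (For a
full bisection `U` this determines `h`.) -/
def IsPi (U : Set G) (h : X ≃ₜ X) : Prop := ∀ γ ∈ U, h (s γ) = r γ

theorem image_mul_setPair (U V : Set G) :
    (fun p : Composable G => mul p.1.1 p.1.2 p.2) '' setPair U V = setMul U V := by
  ext g
  constructor
  · rintro ⟨p, hp, rfl⟩
    exact ⟨_, hp.1, _, hp.2, p.2, rfl⟩
  · rintro ⟨a, ha, b, hb, h, rfl⟩
    exact ⟨⟨(a, b), h⟩, ⟨ha, hb⟩, rfl⟩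

theorem isOpen_setPair {U V : Set G} (hU : IsOpen U) (hV : IsOpen V) : IsOpen (setPair U V) :=
  (hU.prod hV).preimage continuous_subtype_val

theorem isOpen_setMul [IsAmple G] {U V : Set G} (hU : IsOpen U) (hV : IsOpen V) :
    IsOpen (setMul U V) := by
  rw [← image_mul_setPair]
  exact isLocalHomeomorph_mul.isOpenMap _ (isOpen_setPair hU hV)

theorem IsFullBisection.setMul [IsAmple G] {U V : Set G} (hU : IsFullBisection U)
    (hV : IsFullBisection V) : IsFullBisection (setMul U V) where
  isOpen := isOpen_setMul hU.isOpen hV.isOpen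
  injOn_s := by
    rintro _ ⟨a, ha, b, hb, h, rfl⟩ _ ⟨a', ha', b', hb', h', rfl⟩ he
    rw [s_mul, s_mul] at he
    have hbb := hV.injOn_s hb hb' he
    have haa := hU.injOn_s ha ha' (by rw [h, h', hbb])
    exact mul_congr haa hbb h
  injOn_r := by
    rintro _ ⟨a, ha, b, hb, h, rfl⟩ _ ⟨a', ha', b', hb', h', rfl⟩ he
    rw [r_mul, r_mul] at he
    have haa := hU.injOn_r ha ha' he
    have hbb := hV.injOn_r hb hb' (by rw [← h, ← h', haa])
    exact mul_congr haa hbb h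
  image_s := by
    refine eq_univ_of_forall fun x => ?_
    obtain ⟨b, hb, rfl⟩ := hV.image_s.symm ▸ mem_univ x
    obtain ⟨a, ha, hab⟩ := hU.image_s.symm ▸ mem_univ (r b)
    exact ⟨mul a b hab, ⟨a, ha, b, hb, hab, rfl⟩, s_mul _ _ _⟩
  image_r := by
    refine eq_univ_of_forall fun x => ?_
    obtain ⟨a, ha, rfl⟩ := hU.image_r.symm ▸ mem_univ x
    obtain ⟨b, hb, hab⟩ := hV.image_r.symm ▸ mem_univ (s a)
    exact ⟨mul a b hab.symm, ⟨a, ha, b, hb, hab.symm, rfl⟩, r_mul _ _ _⟩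

theorem isOpen_inv_image {U : Set G} (hU : IsOpen U) : IsOpen (inv '' U) := by
  have : inv '' U = inv ⁻¹' U :=
    congrFun (image_eq_preimage_of_inverse inv_inv' inv_inv') U
  rw [this]
  exact hU.preimage TopGroupoid.continuous_inv

theorem IsFullBisection.inv {U : Set G} (hU : IsFullBisection U) :
    IsFullBisection (inv '' U) where
  isOpen := isOpen_inv_image hU.isOpen
  injOn_s := by
    rintro _ ⟨a, ha, rfl⟩ _ ⟨b, hb, rfl⟩ he
    rw [s_inv, s_inv] at he
    rw [hU.injOn_r ha hb he]
  injOn_r := by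
    rintro _ ⟨a, ha, rfl⟩ _ ⟨b, hb, rfl⟩ he
    rw [r_inv, r_inv] at he
    rw [hU.injOn_s ha hb he]
  image_s := by
    rw [image_image, ← hU.image_r]
    exact image_congr fun a _ => s_inv a
  image_r := by
    rw [image_image, ← hU.image_s]
    exact image_congr fun a _ => r_inv a

theorem isFullBisection_range_one [IsAmple G] : IsFullBisection (range (one : X → G)) where
  isOpen := isOpen_range_one
  injOn_s := by
    rintro _ ⟨a, rfl⟩ _ ⟨b, rfl⟩ he
    rw [s_one, s_one] at he
    rw [he]
  injOn_r := by
    rintro _ ⟨a, rfl⟩ _ ⟨b, rfl⟩ he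
    rw [r_one, r_one] at he
    rw [he]
  image_s := eq_univ_of_forall fun x => ⟨one x, ⟨x, rfl⟩, s_one x⟩
  image_r := eq_univ_of_forall fun x => ⟨one x, ⟨x, rfl⟩, r_one x⟩

theorem IsPi.setMul {U V : Set G} {h k : X ≃ₜ X} (hU : IsPi U h) (hV : IsPi V k) :
    IsPi (setMul U V) (h * k) := by
  rintro _ ⟨a, ha, b, hb, hab, rfl⟩
  change h (k _) = _
  rw [s_mul, r_mul, hV b hb, ← hab, hU a ha]

theorem IsPi.inv {U : Set G} {h : X ≃ₜ X} (hU : IsPi U h) : IsPi (inv '' U) h⁻¹ := by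
  rintro _ ⟨a, ha, rfl⟩
  change h.symm _ = _
  rw [s_inv, r_inv, ← hU a ha, h.symm_apply_apply]

variable (G)

/-- The topological full group `[[G]] = {π_U : U a full bisection}`, a group under composition. -/
def FullGroup [IsAmple G] : Subgroup (X ≃ₜ X) where
  carrier := {h | ∃ U : Set G, IsFullBisection U ∧ IsPi U h}
  mul_mem' := by
    rintro h k ⟨U, hU, hUh⟩ ⟨V, hV, hVk⟩
    exact ⟨setMul U V, hU.setMul hV, hUh.setMul hVk⟩
  one_mem' := by
    refine ⟨range one, isFullBisection_range_one, ?_⟩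
    rintro _ ⟨x, rfl⟩
    rw [r_one, s_one]; rfl
  inv_mem' := by
    rintro h ⟨U, hU, hUh⟩
    exact ⟨_, hU.inv, hUh.inv⟩

variable {G}

/-- The set `Û = U ⊔ U⁻¹ ⊔ (G⁽⁰⁾ \ (r(U) ∪ s(U)))`. -/
def hat (U : Set G) : Set G := U ∪ inv '' U ∪ one '' (r '' U ∪ s '' U)ᶜ

/-- A transposition is an element `π_Û` of `[[G]]`, where `U` is a compact bisection with
`r(U) ∩ s(U) = ∅`. -/
def IsTransposition [IsAmple G] (τ : FullGroup G) : Prop :=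
  ∃ U : Set G, IsBisection U ∧ IsCompact U ∧ Disjoint (r '' U) (s '' U) ∧ IsPi (hat U) τ.1

variable (G)

/-- The subgroup `𝒯(G)` of `[[G]]` generated by all transpositions. -/
def transpositionSubgroup [IsAmple G] : Subgroup (FullGroup G) :=
  Subgroup.closure {τ | IsTransposition τ}

variable {G}

/-! ### The index map -/

theorem IsFullBisection.isCompact [IsAmple G] [CompactSpace X] {U : Set G}
    (hU : IsFullBisection U) : IsCompact U := by
  have hemb : IsOpenEmbedding (fun g : U => (s g.1 : X)) :=
    IsOpenEmbedding.of_continuous_injective_isOpenMap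
      (continuous_s.comp continuous_subtype_val) (injOn_iff_injective.1 hU.injOn_s)
      ((IsAmple.isLocalHomeomorph_s (G := G) (X := X)).isOpenMap.comp hU.isOpen.isOpenMap_subtype_val)
  have hr : range (fun g : U => (s g.1 : X)) = univ := by
    rw [← hU.image_s, image_eq_range]
  rw [← Subtype.range_coe (s := U), ← image_univ]
  refine IsCompact.image ?_ continuous_subtype_val
  rw [hemb.isInducing.isCompact_iff, image_univ, hr]
  exact isCompact_univ

/-- In an effective groupoid a full bisection is determined by its homeomorphism. -/
theorem IsFullBisection.eq_of_isPi [IsAmple G] [IsEffective G] {U V : Set G} {h : X ≃ₜ X}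
    (hU : IsFullBisection U) (hV : IsFullBisection V) (hUh : IsPi U h) (hVh : IsPi V h) :
    U = V := by
  have key : ∀ {U V : Set G}, IsFullBisection U → IsFullBisection V → IsPi U h → IsPi V h →
      U ⊆ V := by
    intro U V hU hV hUh hVh g hg
    obtain ⟨k, hk, hkg⟩ := hV.image_s.symm ▸ mem_univ (s g)
    have hsub : TRGroupoid.setMul U (TopGroupoid.inv '' V) ⊆ {g : G | r g = s g} := by
      rintro _ ⟨a, ha, _, ⟨b, hb, rfl⟩, hab, rfl⟩
      rw [r_inv] at hab
      rw [mem_ofPred_eq, r_mul, s_mul, s_inv, ← hUh a ha, ← hVh b hb, hab]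
    have hsub' := interior_maximal hsub (isOpen_setMul hU.isOpen hV.inv.isOpen)
    rw [IsEffective.interior_iso] at hsub'
    obtain ⟨y, hy⟩ := hsub' ⟨g, hg, _, ⟨k, hk, rfl⟩, by rw [r_inv, hkg], rfl⟩
    rw [eq_of_mul_inv_eq_one _ hy.symm]
    exact hk
  exact (key hU hV hUh hVh).antisymm (key hV hU hVh hUh)

section Index

variable [IsAmple G] [T2Space G] [T2Space X] [CompactSpace X]

/-- The indicator `1_U` of a full bisection `U`. -/
noncomputable def IsFullBisection.chain {U : Set G} (hU : IsFullBisection U) : C_c(G, ℤ) :=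
  indicatorCc U hU.isOpen hU.isCompact

theorem IsFullBisection.chain_mem {U : Set G} (hU : IsFullBisection U) :
    hU.chain ∈ (delta₁ G).ker := by
  rw [AddMonoidHom.mem_ker]
  ext x
  change pushforward s _ _ x - pushforward r _ _ x = 0
  rw [chain, pushforward_indicator_apply _ _ _ _ _ hU.injOn_s,
    pushforward_indicator_apply _ _ _ _ _ hU.injOn_r, hU.image_s, hU.image_r, sub_self]

/-- The class `[1_U] ∈ H₁(G)` of a full bisection `U`. -/
noncomputable def IsFullBisection.homClass {U : Set G} (hU : IsFullBisection U) : H₁ G :=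
  QuotientAddGroup.mk ⟨hU.chain, hU.chain_mem⟩

theorem IsFullBisection.homClass_congr {U V : Set G} (hU : IsFullBisection U)
    (hV : IsFullBisection V) (h : U = V) : hU.homClass = hV.homClass := by
  subst h; rfl

theorem IsFullBisection.homClass_setMul {U V : Set G} (hU : IsFullBisection U)
    (hV : IsFullBisection V) :
    (hU.setMul hV).homClass = hU.homClass + hV.homClass := by
  have hWo : IsOpen (setPair U V) := isOpen_setPair hU.isOpen hV.isOpen
  have hWc : IsCompact (setPair U V) := by
    have hcl : IsClosedEmbedding (Subtype.val : Composable G → G × G) :=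
      (isClosed_eq (continuous_s.comp continuous_fst)
        (continuous_r.comp continuous_snd)).isClosedEmbedding_subtypeVal
    exact hcl.isCompact_preimage (hU.isCompact.prod hV.isCompact)
  have i0 : InjOn (fun p : Composable G => p.1.2) (setPair U V) := by
    intro p hp q hq he
    refine Subtype.ext (Prod.ext (hU.injOn_s hp.1 hq.1 ?_) he)
    rw [p.2, q.2]; exact congrArg r he
  have i2 : InjOn (fun p : Composable G => p.1.1) (setPair U V) := by
    intro p hp q hq he
    refine Subtype.ext (Prod.ext he (hV.injOn_r hp.2 hq.2 ?_))
    rw [← p.2, ← q.2]; exact congrArg s he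
  have i1 : InjOn (fun p : Composable G => mul p.1.1 p.1.2 p.2) (setPair U V) := by
    intro p hp q hq he
    refine i0 hp hq (hV.injOn_s hp.2 hq.2 ?_)
    rw [← s_mul _ _ p.2, ← s_mul _ _ q.2]; exact congrArg s he
  have e0 : (fun p : Composable G => p.1.2) '' setPair U V = V := by
    refine subset_antisymm (image_subset_iff.2 fun p hp => hp.2) fun b hb => ?_
    obtain ⟨a, ha, hab⟩ := hU.image_s.symm ▸ mem_univ (r b)
    exact ⟨⟨(a, b), hab⟩, ⟨ha, hb⟩, rfl⟩
  have e2 : (fun p : Composable G => p.1.1) '' setPair U V = U := by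
    refine subset_antisymm (image_subset_iff.2 fun p hp => hp.1) fun a ha => ?_
    obtain ⟨b, hb, hab⟩ := hV.image_r.symm ▸ mem_univ (s a)
    exact ⟨⟨(a, b), hab.symm⟩, ⟨ha, hb⟩, rfl⟩
  rw [homClass, homClass, homClass, ← QuotientAddGroup.mk_add, QuotientAddGroup.eq,
    AddSubgroup.mem_addSubgroupOf]
  refine ⟨indicatorCc (setPair U V) hWo hWc, ?_⟩
  ext g
  change pushforward (fun p : Composable G => p.1.2) isLocalHomeomorph_snd _ g
      - pushforward (fun p : Composable G => mul p.1.1 p.1.2 p.2) isLocalHomeomorph_mul _ g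
      + pushforward (fun p : Composable G => p.1.1) isLocalHomeomorph_fst _ g =
    -((TRGroupoid.setMul U V).indicator (fun _ => (1 : ℤ)) g) +
      (U.indicator (fun _ => (1 : ℤ)) g + V.indicator (fun _ => (1 : ℤ)) g)
  rw [pushforward_indicator_apply _ _ _ _ _ i0, pushforward_indicator_apply _ _ _ _ _ i1,
    pushforward_indicator_apply _ _ _ _ _ i2, e0, e2, image_mul_setPair]
  ring

variable (G)

/-- The index map `I : [[G]] → H₁(G)`, `π_U ↦ [1_U]`. -/
noncomputable def indexMap [IsEffective G] : FullGroup G →* Multiplicative (H₁ G) :=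
  MonoidHom.mk' (fun h => Multiplicative.ofAdd (h.2.choose_spec.1.homClass)) fun h k => by
    rw [← ofAdd_add, ← IsFullBisection.homClass_setMul]
    exact congrArg _ (IsFullBisection.homClass_congr _ _
      ((h * k).2.choose_spec.1.eq_of_isPi (h.2.choose_spec.1.setMul k.2.choose_spec.1)
        (h * k).2.choose_spec.2 (h.2.choose_spec.2.setMul k.2.choose_spec.2)))

theorem indexMap_eq [IsEffective G] (h : FullGroup G) {U : Set G} (hU : IsFullBisection U)
    (hUh : IsPi U h.1) : indexMap G h = Multiplicative.ofAdd hU.homClass :=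
  congrArg Multiplicative.ofAdd (IsFullBisection.homClass_congr _ _
    (h.2.choose_spec.1.eq_of_isPi hU h.2.choose_spec.2 hUh))

/-- Property TR for an effective Hausdorff ample groupoid with compact unit space: the subgroup
generated by the transpositions is the kernel of the index map. -/
def PropertyTR [IsEffective G] : Prop := transpositionSubgroup G = (indexMap G).ker

end Index

end Groupoid

/-! ### Groupoids of germs -/

/-- A family of local homeomorphisms of `X` (homeomorphisms between open subsets) whose germs
contain the identity germs and are closed under inversion and composition; any inverse semigroup of
local homeomorphisms containing the identity is an example. -/
structure GermSystem (X : Type*) [TopologicalSpace X] where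
  carrier : Set (OpenPartialHomeomorph X X)
  exists_id : ∀ x, ∃ φ ∈ carrier, x ∈ φ.source ∧ φ =ᶠ[𝓝 x] id
  exists_symm : ∀ φ ∈ carrier, ∀ x ∈ φ.source,
    ∃ χ ∈ carrier, φ x ∈ χ.source ∧ χ =ᶠ[𝓝 (φ x)] φ.symm
  exists_comp : ∀ ψ ∈ carrier, ∀ φ ∈ carrier, ∀ x ∈ φ.source, φ x ∈ ψ.source →
    ∃ χ ∈ carrier, x ∈ χ.source ∧ χ =ᶠ[𝓝 x] ψ ∘ φ

section Germs

open TopGroupoid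

variable {X : Type*} [TopologicalSpace X] (P : GermSystem X)

/-- Pairs `(φ, x)` with `φ` in the family and `x` in the domain of `φ`. -/
def PreGerm : Type _ := {p : OpenPartialHomeomorph X X × X // p.1 ∈ P.carrier ∧ p.2 ∈ p.1.source}

/-- `(φ, x) ∼ (ψ, y)` if `x = y` and `φ` and `ψ` coincide in a neighbourhood of `x`. -/
instance germSetoid : Setoid (PreGerm P) where
  r p q := p.1.2 = q.1.2 ∧ p.1.1 =ᶠ[𝓝 p.1.2] q.1.1
  iseqv :=
    { refl := fun _ => ⟨rfl, EventuallyEq.rfl⟩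
      symm := fun h => ⟨h.1.symm, h.1 ▸ h.2.symm⟩
      trans := fun h k => ⟨h.1.trans k.1, h.2.trans (h.1 ▸ k.2)⟩ }

/-- The arrow space of the groupoid of germs. -/
def Germ : Type _ := Quotient (germSetoid P)

variable {P}

namespace Germ

/-- The germ `[φ, x]`. -/
def mk (φ : OpenPartialHomeomorph X X) (hφ : φ ∈ P.carrier) (x : X) (hx : x ∈ φ.source) : Germ P :=
  Quotient.mk _ ⟨(φ, x), hφ, hx⟩

theorem mk_eq_mk {φ ψ : OpenPartialHomeomorph X X} {hφ : φ ∈ P.carrier} {hψ : ψ ∈ P.carrier}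
    {x y : X} {hx : x ∈ φ.source} {hy : y ∈ ψ.source} :
    mk φ hφ x hx = mk ψ hψ y hy ↔ x = y ∧ φ =ᶠ[𝓝 x] ψ :=
  Quotient.eq (r := germSetoid P)

theorem exists_rep (g : Germ P) : ∃ φ hφ x hx, g = mk φ hφ x hx := by
  induction g using Quotient.inductionOn with
  | h p => exact ⟨p.1.1, p.2.1, p.1.2, p.2.2, rfl⟩

/-- The source `x` of the germ `[φ, x]`. -/
def src : Germ P → X := Quotient.lift (fun p : PreGerm P => p.1.2) fun _ _ h => h.1

/-- The range `φ x` of the germ `[φ, x]`. -/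
def rng : Germ P → X :=
  Quotient.lift (fun p : PreGerm P => p.1.1 p.1.2) fun p q h => by
    rw [← h.1]; exact h.2.eq_of_nhds

theorem src_mk (φ : OpenPartialHomeomorph X X) (hφ : φ ∈ P.carrier) (x : X) (hx : x ∈ φ.source) :
    src (mk φ hφ x hx) = x := rfl

theorem rng_mk (φ : OpenPartialHomeomorph X X) (hφ : φ ∈ P.carrier) (x : X) (hx : x ∈ φ.source) :
    rng (mk φ hφ x hx) = φ x := rfl

theorem exists_unit (x : X) : ∃ k : Germ P, ∀ (χ : OpenPartialHomeomorph X X) (hχ : χ ∈ P.carrier) (hx : x ∈ χ.source),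
    χ =ᶠ[𝓝 x] id → k = mk χ hχ x hx := by
  obtain ⟨φ, hφ, hx, h⟩ := P.exists_id x
  exact ⟨mk φ hφ x hx, fun χ hχ hx' h' => mk_eq_mk.2 ⟨rfl, h.trans h'.symm⟩⟩

theorem exists_inverse (g : Germ P) : ∃ k : Germ P, ∀ (φ : OpenPartialHomeomorph X X) (hφ : φ ∈ P.carrier) (x : X)
    (hx : x ∈ φ.source) (χ : OpenPartialHomeomorph X X) (hχ : χ ∈ P.carrier) (hx' : φ x ∈ χ.source),
    g = mk φ hφ x hx → χ =ᶠ[𝓝 (φ x)] φ.symm → k = mk χ hχ (φ x) hx' := by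
  obtain ⟨φ, hφ, x, hx, rfl⟩ := exists_rep g
  obtain ⟨χ, hχ, hx', h⟩ := P.exists_symm φ hφ x hx
  refine ⟨mk χ hχ _ hx', fun φ₁ hφ₁ x₁ hx₁ χ₁ hχ₁ hx₁' he h₁ => ?_⟩
  replace he := mk_eq_mk.1 he
  obtain ⟨rfl, he⟩ := he
  have e := he.eq_of_nhds
  refine mk_eq_mk.2 ⟨e, ?_⟩
  rw [← e] at h₁
  refine h.trans (EventuallyEq.trans ?_ h₁.symm)
  -- near `φ x`, both inverses agree
  have h2 : ∀ᶠ z in 𝓝 (φ x), φ (φ.symm z) = φ₁ (φ.symm z) := by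
    have := (φ.symm.continuousAt (φ.map_source hx))
    rw [ContinuousAt, φ.left_inv hx] at this
    exact this.eventually he
  have h3 : ∀ᶠ z in 𝓝 (φ x), z ∈ φ.target := φ.open_target.mem_nhds (φ.map_source hx)
  have h4 : ∀ᶠ z in 𝓝 (φ x), φ.symm z ∈ φ₁.source := by
    have := (φ.symm.continuousAt (φ.map_source hx))
    rw [ContinuousAt, φ.left_inv hx] at this
    exact this.eventually (φ₁.open_source.mem_nhds hx₁)
  filter_upwards [h2, h3, h4] with z h2 h3 h4
  rw [φ.right_inv h3] at h2
  rw [h2, φ₁.left_inv h4, ← h2]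

theorem exists_product (g h : Germ P) (H : src g = rng h) : ∃ k : Germ P,
    ∀ (ψ : OpenPartialHomeomorph X X) (hψ : ψ ∈ P.carrier) (z : X) (hz : z ∈ ψ.source)
      (φ : OpenPartialHomeomorph X X) (hφ : φ ∈ P.carrier) (x : X) (hx : x ∈ φ.source)
      (χ : OpenPartialHomeomorph X X) (hχ : χ ∈ P.carrier) (hx' : x ∈ χ.source), g = mk ψ hψ z hz → h = mk φ hφ x hx →
      χ =ᶠ[𝓝 x] ψ ∘ φ → k = mk χ hχ x hx' := by
  obtain ⟨ψ, hψ, z, hz, rfl⟩ := exists_rep g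
  obtain ⟨φ, hφ, x, hx, rfl⟩ := exists_rep h
  obtain rfl : z = φ x := by exact H
  obtain ⟨χ, hχ, hx', hc⟩ := P.exists_comp ψ hψ φ hφ x hx hz
  refine ⟨mk χ hχ x hx', ?_⟩
  intro ψ₁ hψ₁ z₁ hz₁ φ₁ hφ₁ x₁ hx₁ χ₁ hχ₁ hx₁' e1 e2 hc₁
  replace e1 := mk_eq_mk.1 e1
  obtain ⟨rfl, e1⟩ := e1
  replace e2 := mk_eq_mk.1 e2
  obtain ⟨rfl, e2⟩ := e2
  refine mk_eq_mk.2 ⟨rfl, hc.trans (EventuallyEq.trans ?_ hc₁.symm)⟩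
  filter_upwards [e2, (φ.continuousAt hx).eventually e1] with y h2 h1
  change ψ (φ y) = ψ₁ (φ₁ y)
  rw [← h2]; exact h1

/-- The identity germ at `x`. -/
noncomputable def unit (x : X) : Germ P := (exists_unit x).choose

/-- The germ `[φ, x]⁻¹ = [φ⁻¹, φ x]`. -/
noncomputable def inverse (g : Germ P) : Germ P := (exists_inverse g).choose

/-- The germ `[ψ, φ x] [φ, x] = [ψ ∘ φ, x]`. -/
noncomputable def product (g h : Germ P) (H : src g = rng h) : Germ P :=
  (exists_product g h H).choose

theorem unit_eq {x : X} {χ : OpenPartialHomeomorph X X} (hχ : χ ∈ P.carrier) (hx : x ∈ χ.source)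
    (h : χ =ᶠ[𝓝 x] id) : unit x = mk χ hχ x hx :=
  (exists_unit x).choose_spec χ hχ hx h

theorem inverse_mk {φ χ : OpenPartialHomeomorph X X} {x : X} {hφ : φ ∈ P.carrier}
    {hx : x ∈ φ.source} (hχ : χ ∈ P.carrier) (hx' : φ x ∈ χ.source)
    (h : χ =ᶠ[𝓝 (φ x)] φ.symm) : inverse (mk φ hφ x hx) = mk χ hχ (φ x) hx' :=
  (exists_inverse (mk φ hφ x hx)).choose_spec φ hφ x hx χ hχ hx' rfl h

theorem product_mk {ψ φ χ : OpenPartialHomeomorph X X} {z x : X} {hψ : ψ ∈ P.carrier}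
    {hz : z ∈ ψ.source} {hφ : φ ∈ P.carrier} {hx : x ∈ φ.source}
    (H : src (mk ψ hψ z hz) = rng (mk φ hφ x hx)) (hχ : χ ∈ P.carrier) (hx' : x ∈ χ.source)
    (h : χ =ᶠ[𝓝 x] ψ ∘ φ) : product (mk ψ hψ z hz) (mk φ hφ x hx) H = mk χ hχ x hx' :=
  (exists_product _ _ H).choose_spec ψ hψ z hz φ hφ x hx χ hχ hx' rfl rfl h

/-- The set `{[φ, x] : x ∈ V}`. -/
def basicSet (φ : OpenPartialHomeomorph X X) (hφ : φ ∈ P.carrier) (V : Set X) : Set (Germ P) :=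
  {g | ∃ x hx, x ∈ V ∧ mk φ hφ x hx = g}

/-- The topology with the sets `{[φ, x] : x ∈ V}` as a basis, for `φ` in the family and `V` an open
subset of the domain of `φ`. -/
instance : TopologicalSpace (Germ P) :=
  TopologicalSpace.generateFrom
    {W | ∃ φ hφ V, IsOpen V ∧ V ⊆ φ.source ∧ W = basicSet φ hφ V}

theorem isOpen_iff {T : Set (Germ P)} : IsOpen T ↔ ∀ φ hφ x hx, mk φ hφ x hx ∈ T →
    ∀ᶠ y in 𝓝 x, ∀ hy, mk φ hφ y hy ∈ T := by
  constructor
  · intro h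
    induction h with
    | basic W hW =>
      obtain ⟨ψ, hψ, V, hV, hVs, rfl⟩ := hW
      rintro φ hφ x hx ⟨x', hx', hxV, he⟩
      replace he := mk_eq_mk.1 he
      obtain ⟨rfl, he⟩ := he
      filter_upwards [he.eventually_nhds, hV.mem_nhds hxV] with y h1 h2 hy
      exact ⟨y, hVs h2, h2, mk_eq_mk.2 ⟨rfl, h1⟩⟩
    | univ => exact fun φ hφ x hx _ => Eventually.of_forall fun y hy => trivial
    | inter S T _ _ hS hT =>
      intro φ hφ x hx hm
      filter_upwards [hS φ hφ x hx hm.1, hT φ hφ x hx hm.2] with y h1 h2 hy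
      exact ⟨h1 hy, h2 hy⟩
    | sUnion S _ hS =>
      rintro φ hφ x hx ⟨T, hT, hm⟩
      filter_upwards [hS T hT φ hφ x hx hm] with y h1 hy
      exact ⟨T, hT, h1 hy⟩
  · intro h
    rw [isOpen_iff_forall_mem_open]
    intro g hg
    obtain ⟨φ, hφ, x, hx, rfl⟩ := exists_rep g
    obtain ⟨V, hV, hVo, hxV⟩ := eventually_nhds_iff.1 (h φ hφ x hx hg)
    refine ⟨basicSet φ hφ (V ∩ φ.source), ?_, ?_, ⟨x, hx, ⟨hxV, hx⟩, rfl⟩⟩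
    · rintro _ ⟨y, hy, hyV, rfl⟩
      exact hV y hyV.1 hy
    · exact TopologicalSpace.isOpen_generateFrom_of_mem
        ⟨φ, hφ, _, hVo.inter φ.open_source, inter_subset_right, rfl⟩

theorem isOpen_basicSet (φ : OpenPartialHomeomorph X X) (hφ : φ ∈ P.carrier) {V : Set X}
    (hV : IsOpen V) : IsOpen (basicSet φ hφ V) := by
  have : basicSet φ hφ V = basicSet φ hφ (V ∩ φ.source) := by
    ext g
    constructor
    · rintro ⟨x, hx, h, rfl⟩; exact ⟨x, hx, ⟨h, hx⟩, rfl⟩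
    · rintro ⟨x, hx, h, rfl⟩; exact ⟨x, hx, h.1, rfl⟩
  rw [this]
  exact TopologicalSpace.isOpen_generateFrom_of_mem
    ⟨φ, hφ, _, hV.inter φ.open_source, inter_subset_right, rfl⟩

theorem continuous_src : Continuous (src : Germ P → X) := by
  refine ⟨fun O hO => isOpen_iff.2 fun φ hφ x hx h => ?_⟩
  filter_upwards [hO.mem_nhds h] with y hyO hy using hyO

theorem continuous_rng : Continuous (rng : Germ P → X) := by
  refine ⟨fun O hO => isOpen_iff.2 fun φ hφ x hx h => ?_⟩
  filter_upwards [(φ.continuousAt hx).preimage_mem_nhds (hO.mem_nhds h)] with y hyO hy using hyO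

theorem continuous_unit : Continuous (unit : X → Germ P) := by
  refine ⟨fun T hT => ?_⟩
  rw [_root_.isOpen_iff_mem_nhds]
  intro x hx
  obtain ⟨χ, hχ, hxs, h⟩ := P.exists_id x
  have hx' : mk χ hχ x hxs ∈ T := by rw [← unit_eq hχ hxs h]; exact hx
  filter_upwards [isOpen_iff.1 hT χ hχ x hxs hx', h.eventually_nhds,
    χ.open_source.mem_nhds hxs] with y h1 h2 h3
  rw [mem_preimage, unit_eq hχ h3 h2]
  exact h1 h3

theorem continuous_inverse : Continuous (inverse : Germ P → Germ P) := by
  refine ⟨fun T hT => isOpen_iff.2 fun φ hφ x hx hm => ?_⟩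
  obtain ⟨χ, hχ, hxs, h⟩ := P.exists_symm φ hφ x hx
  rw [mem_preimage, inverse_mk hχ hxs h] at hm
  have hc := φ.continuousAt hx
  filter_upwards [hc.eventually (isOpen_iff.1 hT χ hχ _ hxs hm), hc.eventually h.eventually_nhds,
    hc.eventually (χ.open_source.mem_nhds hxs)] with y h1 h2 h3 hy
  rw [mem_preimage, inverse_mk hχ h3 h2]
  exact h1 h3

theorem continuous_product :
    Continuous fun p : {p : Germ P × Germ P // src p.1 = rng p.2} => product p.1.1 p.1.2 p.2 := by
  refine ⟨fun T hT => ?_⟩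
  rw [_root_.isOpen_iff_mem_nhds]
  rintro ⟨⟨g, h⟩, H⟩ hm
  obtain ⟨ψ, hψ, z, hz, rfl⟩ := exists_rep g
  obtain ⟨φ, hφ, x, hx, rfl⟩ := exists_rep h
  obtain rfl : z = φ x := by exact H
  obtain ⟨χ, hχ, hx', hc⟩ := P.exists_comp ψ hψ φ hφ x hx hz
  have hm' : mk χ hχ x hx' ∈ T := by
    have e := product_mk (hψ := hψ) (hz := hz) (hφ := hφ) (hx := hx) H hχ hx' hc
    rw [← e]; exact hm
  obtain ⟨V, hV, hVo, hxV⟩ := eventually_nhds_iff.1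
    (((isOpen_iff.1 hT χ hχ x hx' hm').and hc.eventually_nhds).and
      (χ.open_source.mem_nhds hx'))
  have hn : (basicSet ψ hψ univ ×ˢ basicSet φ hφ V) ∈
      𝓝 (mk ψ hψ (φ x) hz, mk φ hφ x hx) :=
    ((isOpen_basicSet ψ hψ isOpen_univ).prod (isOpen_basicSet φ hφ hVo)).mem_nhds
      ⟨⟨_, hz, trivial, rfl⟩, ⟨x, hx, hxV, rfl⟩⟩
  rw [nhds_induced]
  refine ⟨_, hn, ?_⟩
  rintro ⟨⟨g, h⟩, H'⟩ ⟨⟨z', hz', -, he⟩, ⟨y, hy, hyV, he'⟩⟩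
  change mk ψ hψ z' hz' = g at he
  change mk φ hφ y hy = h at he'
  subst he he'
  obtain ⟨⟨h1, h2⟩, h3⟩ := hV y hyV
  rw [mem_preimage]
  change product (mk ψ hψ z' hz') (mk φ hφ y hy) H' ∈ T
  rw [product_mk H' hχ h3 h2]
  exact h1 h3

/-- The groupoid of germs is a topological groupoid. -/
noncomputable instance : TopGroupoid (Germ P) X where
  s := src
  r := rng
  one := unit
  inv := inverse
  mul := product
  s_one x := by
    obtain ⟨χ, hχ, hx, h⟩ := P.exists_id x
    rw [unit_eq hχ hx h, src_mk]
  r_one x := by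
    obtain ⟨χ, hχ, hx, h⟩ := P.exists_id x
    rw [unit_eq hχ hx h, rng_mk]; exact h.eq_of_nhds
  s_inv g := by
    obtain ⟨φ, hφ, x, hx, rfl⟩ := exists_rep g
    obtain ⟨χ, hχ, hx', h⟩ := P.exists_symm φ hφ x hx
    rw [inverse_mk hχ hx' h, src_mk, rng_mk]
  r_inv g := by
    obtain ⟨φ, hφ, x, hx, rfl⟩ := exists_rep g
    obtain ⟨χ, hχ, hx', h⟩ := P.exists_symm φ hφ x hx
    rw [inverse_mk hχ hx' h, src_mk, rng_mk, h.eq_of_nhds, φ.left_inv hx]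
  s_mul g h H := by
    obtain ⟨ψ, hψ, z, hz, rfl⟩ := exists_rep g
    obtain ⟨φ, hφ, x, hx, rfl⟩ := exists_rep h
    obtain rfl : z = φ x := by exact H
    obtain ⟨χ, hχ, hx', hc⟩ := P.exists_comp ψ hψ φ hφ x hx hz
    rw [product_mk H hχ hx' hc, src_mk, src_mk]
  r_mul g h H := by
    obtain ⟨ψ, hψ, z, hz, rfl⟩ := exists_rep g
    obtain ⟨φ, hφ, x, hx, rfl⟩ := exists_rep h
    obtain rfl : z = φ x := by exact H
    obtain ⟨χ, hχ, hx', hc⟩ := P.exists_comp ψ hψ φ hφ x hx hz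
    rw [product_mk H hχ hx' hc, rng_mk, rng_mk]; exact hc.eq_of_nhds
  one_mul g x H := by
    obtain ⟨φ, hφ, y, hy, rfl⟩ := exists_rep g
    obtain ⟨χ, hχ, hx, h⟩ := P.exists_id x
    revert H
    rw [unit_eq hχ hx h]
    intro H
    obtain rfl : x = φ y := by exact H
    refine product_mk H hφ hy ?_
    filter_upwards [(φ.continuousAt hy).eventually h] with t ht using ht.symm
  mul_one g x H := by
    obtain ⟨φ, hφ, y, hy, rfl⟩ := exists_rep g
    obtain ⟨χ, hχ, hx, h⟩ := P.exists_id x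
    revert H
    rw [unit_eq hχ hx h]
    intro H
    obtain rfl : y = x := H.trans h.eq_of_nhds
    refine product_mk H hφ hy ?_
    filter_upwards [h] with t ht
    exact (congrArg φ ht).symm
  inv_mul g H := by
    obtain ⟨φ, hφ, x, hx, rfl⟩ := exists_rep g
    obtain ⟨χ, hχ, hx', h⟩ := P.exists_symm φ hφ x hx
    obtain ⟨ι, hι, hxι, hi⟩ := P.exists_id x
    change _ = unit x
    revert H
    rw [inverse_mk hχ hx' h, unit_eq hι hxι hi]
    intro H
    refine product_mk H hι hxι ?_
    filter_upwards [hi, (φ.continuousAt hx).eventually h, φ.open_source.mem_nhds hx]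
      with t h1 h2 h3
    exact h1.trans ((φ.left_inv h3).symm.trans h2.symm)
  mul_inv g H := by
    obtain ⟨φ, hφ, x, hx, rfl⟩ := exists_rep g
    obtain ⟨χ, hχ, hx', h⟩ := P.exists_symm φ hφ x hx
    obtain ⟨ι, hι, hxι, hi⟩ := P.exists_id (φ x)
    change _ = unit (φ x)
    revert H
    rw [inverse_mk hχ hx' h, unit_eq hι hxι hi]
    intro H
    refine product_mk H hι hxι ?_
    filter_upwards [hi, h, φ.open_target.mem_nhds (φ.map_source hx)] with t h1 h2 h3
    exact h1.trans ((φ.right_inv h3).symm.trans (congrArg φ h2).symm)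
  mul_assoc g h k hgh hhk := by
    obtain ⟨ψ, hψ, z, hz, rfl⟩ := exists_rep g
    obtain ⟨φ, hφ, x, hx, rfl⟩ := exists_rep h
    obtain ⟨θ, hθ, y, hy, rfl⟩ := exists_rep k
    obtain rfl : z = φ x := by exact hgh
    obtain rfl : x = θ y := by exact hhk
    obtain ⟨α, hα, hxα, hcα⟩ := P.exists_comp ψ hψ φ hφ _ hx hz
    obtain ⟨β, hβ, hyβ, hcβ⟩ := P.exists_comp φ hφ θ hθ _ hy hx
    obtain ⟨γ, hγ, hyγ, hcγ⟩ := P.exists_comp α hα θ hθ _ hy hxα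
    have hθc := θ.continuousAt hy
    generalize_proofs p1 p2
    revert p1 p2
    rw [product_mk hgh hα hxα hcα, product_mk hhk hβ hyβ hcβ]
    intro p1 p2
    rw [product_mk p1 hγ hyγ hcγ, product_mk p2 hγ hyγ]
    filter_upwards [hcγ, hθc.eventually hcα, hcβ] with t h1 h2 h3
    rw [h1]
    exact h2.trans (congrArg ψ h3).symm
  continuous_s := continuous_src
  continuous_r := continuous_rng
  continuous_one := continuous_unit
  continuous_inv := continuous_inverse
  continuous_mul := continuous_product

theorem isLocalHomeomorph_src : IsLocalHomeomorph (src : Germ P → X) := by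
  refine isLocalHomeomorph_of_isOpenMap continuous_src ?_ ?_
  · intro T hT
    rw [_root_.isOpen_iff_mem_nhds]
    rintro _ ⟨g, hg, rfl⟩
    obtain ⟨φ, hφ, x, hx, rfl⟩ := exists_rep g
    filter_upwards [isOpen_iff.1 hT φ hφ x hx hg, φ.open_source.mem_nhds hx] with y h1 h2
    exact ⟨_, h1 h2, rfl⟩
  · intro g
    obtain ⟨φ, hφ, x, hx, rfl⟩ := exists_rep g
    refine ⟨basicSet φ hφ univ, isOpen_basicSet φ hφ isOpen_univ, ⟨x, hx, trivial, rfl⟩, ?_⟩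
    rintro _ ⟨y, hy, -, rfl⟩ _ ⟨y', hy', -, rfl⟩ he
    exact mk_eq_mk.2 ⟨he, EventuallyEq.rfl⟩

theorem isLocalHomeomorph_rng : IsLocalHomeomorph (rng : Germ P → X) := by
  let e : Germ P ≃ₜ Germ P :=
    { toFun := inverse
      invFun := inverse
      left_inv := inv_inv'
      right_inv := inv_inv'
      continuous_toFun := continuous_inverse
      continuous_invFun := continuous_inverse }
  have h : (rng : Germ P → X) = src ∘ e := by
    ext g; exact (s_inv g).symm
  rw [h]
  exact isLocalHomeomorph_src.comp e.isLocalHomeomorph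

theorem isAmple {B : Set (Set X)} (hB : TopologicalSpace.IsTopologicalBasis B)
    (hc : ∀ U ∈ B, IsCompact U) : IsAmple (Germ P) where
  isLocalHomeomorph_s := isLocalHomeomorph_src
  isLocalHomeomorph_r := isLocalHomeomorph_rng
  exists_basis := ⟨B, hB, hc⟩

instance [IsAmple (Germ P)] : IsEffective (Germ P) where
  interior_iso := by
    refine subset_antisymm (fun g hg => ?_) (interior_maximal ?_ isOpen_range_one)
    · obtain ⟨φ, hφ, x, hx, rfl⟩ := exists_rep g
      have h := isOpen_iff.1 isOpen_interior φ hφ x hx hg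
      refine ⟨x, unit_eq hφ hx ?_⟩
      filter_upwards [h, φ.open_source.mem_nhds hx] with y h1 h2
      have h3 : (mk φ hφ y h2 : Germ P) ∈ {g : Germ P | r g = s g} := interior_subset (h1 h2)
      exact h3
    · rintro _ ⟨x, rfl⟩
      change r (one x) = s (one x)
      rw [r_one, s_one]

theorem t2Space [T2Space X]
    (h : ∀ φ ∈ P.carrier, ∀ ψ ∈ P.carrier, ∀ x ∈ φ.source, x ∈ ψ.source →
      (∃ᶠ y in 𝓝 x, φ =ᶠ[𝓝 y] ψ) → φ =ᶠ[𝓝 x] ψ) : T2Space (Germ P) := by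
  refine ⟨fun g k hgk => ?_⟩
  by_cases hs : src g = src k
  · obtain ⟨φ, hφ, x, hx, rfl⟩ := exists_rep g
    obtain ⟨ψ, hψ, y, hy, rfl⟩ := exists_rep k
    obtain rfl : x = y := hs
    have h1 : ¬ ∃ᶠ y in 𝓝 x, φ =ᶠ[𝓝 y] ψ := fun hf =>
      hgk (mk_eq_mk.2 ⟨rfl, h φ hφ ψ hψ x hx hy hf⟩)
    rw [not_frequently] at h1
    obtain ⟨V, hV, hVo, hxV⟩ := eventually_nhds_iff.1 h1
    refine ⟨basicSet φ hφ V, basicSet ψ hψ V, isOpen_basicSet _ _ hVo, isOpen_basicSet _ _ hVo,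
      ⟨x, hx, hxV, rfl⟩, ⟨x, hy, hxV, rfl⟩, ?_⟩
    rw [Set.disjoint_left]
    rintro _ ⟨z, hz, hzV, rfl⟩ ⟨w, hw, hwV, he⟩
    replace he := mk_eq_mk.1 he
    obtain ⟨rfl, he⟩ := he
    exact hV w hwV he.symm
  · obtain ⟨U, V, hU, hV, h1, h2, hd⟩ := t2_separation hs
    exact ⟨src ⁻¹' U, src ⁻¹' V, hU.preimage continuous_src, hV.preimage continuous_src, h1, h2,
      hd.preimage _⟩

end Germ

end Germs

/-! ### Infinite words -/

section Words

variable {A : Type*}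

/-- The infinite word `x ξ`. -/
def cons (x : A) (ξ : ℕ → A) : ℕ → A
  | 0 => x
  | n + 1 => ξ n

/-- The infinite word `w ξ`. -/
def prepend : List A → (ℕ → A) → ℕ → A
  | [], ξ => ξ
  | x :: w, ξ => cons x (prepend w ξ)

/-- The infinite word obtained from `ξ` by removing the first `k` letters. -/
def drop (k : ℕ) (ξ : ℕ → A) : ℕ → A := fun n => ξ (n + k)

/-- The cylinder `Z(w) = {w ξ : ξ ∈ A^∞}`. -/
def cylinder (w : List A) : Set (ℕ → A) := range (prepend w)

theorem cons_drop (ξ : ℕ → A) : cons (ξ 0) (drop 1 ξ) = ξ := by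
  funext n; cases n <;> rfl

theorem cons_inj {x y : A} {ξ ζ : ℕ → A} (h : cons x ξ = cons y ζ) : x = y ∧ ξ = ζ :=
  ⟨congrFun h 0, funext fun n => congrFun h (n + 1)⟩

theorem drop_prepend (w : List A) (ξ : ℕ → A) : drop w.length (prepend w ξ) = ξ := by
  induction w with
  | nil => rfl
  | cons x w ih => exact ih

theorem prepend_append (w v : List A) (ξ : ℕ → A) :
    prepend (w ++ v) ξ = prepend w (prepend v ξ) := by
  induction w with
  | nil => rfl
  | cons x w ih => exact congrArg (cons x) ih

theorem prepend_inj {w v : List A} (h : w.length = v.length) {ξ ζ : ℕ → A}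
    (he : prepend w ξ = prepend v ζ) : w = v ∧ ξ = ζ := by
  induction w generalizing v with
  | nil =>
    cases v with
    | nil => exact ⟨rfl, he⟩
    | cons y v => simp at h
  | cons x w ih =>
    cases v with
    | nil => simp at h
    | cons y v =>
      obtain ⟨h1, h2⟩ := cons_inj he
      obtain ⟨h3, h4⟩ := ih (by simpa using h) h2
      exact ⟨by rw [h1, h3], h4⟩

theorem cylinder_unique {w v : List A} (h : w.length = v.length) {ξ : ℕ → A}
    (hw : ξ ∈ cylinder w) (hv : ξ ∈ cylinder v) : w = v := by
  obtain ⟨ζ, rfl⟩ := hw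
  obtain ⟨θ, hθ⟩ := hv
  exact (prepend_inj h hθ.symm).1

theorem exists_prepend_eq (n : ℕ) (ξ : ℕ → A) :
    ∃ w : List A, ξ ∈ cylinder w ∧ ∀ ζ ∈ cylinder w, ∀ i < n, ζ i = ξ i := by
  induction n generalizing ξ with
  | zero => exact ⟨[], ⟨ξ, rfl⟩, fun _ _ i hi => by omega⟩
  | succ n ih =>
    obtain ⟨w, ⟨ζ, hζ⟩, h⟩ := ih (drop 1 ξ)
    refine ⟨ξ 0 :: w, ⟨ζ, ?_⟩, ?_⟩
    · change cons _ (prepend w ζ) = _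
      rw [hζ, cons_drop]
    · rintro _ ⟨θ, rfl⟩ i hi
      cases i with
      | zero => rfl
      | succ i => exact h _ ⟨θ, rfl⟩ i (by omega)

variable [TopologicalSpace A]

theorem continuous_prepend (w : List A) : Continuous (prepend w) := by
  induction w with
  | nil => exact continuous_id
  | cons x w ih =>
    refine continuous_pi fun n => ?_
    cases n with
    | zero => exact continuous_const
    | succ n => exact (continuous_apply n).comp ih

theorem continuous_drop (k : ℕ) : Continuous (drop k : (ℕ → A) → ℕ → A) :=
  continuous_pi fun n => continuous_apply (n + k)

theorem exists_cylinder_subset {V : Set (ℕ → A)} (hV : IsOpen V) {ξ : ℕ → A} (hξ : ξ ∈ V) :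
    ∃ w, ξ ∈ cylinder w ∧ cylinder w ⊆ V := by
  obtain ⟨I, u, hu, hs⟩ := isOpen_pi_iff.1 hV ξ hξ
  obtain ⟨w, hw, h⟩ := exists_prepend_eq (I.sup id + 1) ξ
  refine ⟨w, hw, fun ζ hζ => hs fun i hi => ?_⟩
  rw [h ζ hζ i (Nat.lt_succ_of_le (Finset.le_sup (f := id) hi))]
  exact (hu i hi).2

variable [DiscreteTopology A]

theorem isOpen_cylinder (w : List A) : IsOpen (cylinder w) := by
  induction w with
  | nil =>
    have : cylinder ([] : List A) = univ := eq_univ_of_forall fun ξ => ⟨ξ, rfl⟩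
    rw [this]; exact isOpen_univ
  | cons x w ih =>
    have : cylinder (x :: w) = (fun ξ : ℕ → A => ξ 0) ⁻¹' {x} ∩ drop 1 ⁻¹' cylinder w := by
      ext ξ
      constructor
      · rintro ⟨ζ, rfl⟩
        exact ⟨rfl, ζ, rfl⟩
      · rintro ⟨h, ζ, hζ⟩
        refine ⟨ζ, ?_⟩
        change cons x (prepend w ζ) = ξ
        rw [hζ, ← show ξ 0 = x from h, cons_drop]
    rw [this]
    exact ((isOpen_discrete _).preimage (continuous_apply 0)).inter (ih.preimage (continuous_drop 1))

end Words

/-! ### Self-similar groups -/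

/-- A self-similar group `(Γ, A)`: a faithful action of `Γ` by automorphisms on the rooted tree
`List A` of finite words such that for all `γ` and `x` there are `y` and `η` with
`γ · (x w) = y (η · w)` for every word `w`. (This condition and `γ · ∅ = ∅` imply that the
permutations preserve length and prefixes.) -/
structure SelfSimilarGroup (Γ : Type*) [Group Γ] (A : Type*) where
  act : Γ →* Equiv.Perm (List A)
  faithful : Function.Injective act
  act_nil : ∀ γ, act γ [] = []
  exists_restrict : ∀ γ x, ∃ y η, ∀ w, act γ (x :: w) = y :: act η w

namespace SelfSimilarGroup

variable {Γ : Type*} [Group Γ] {A : Type*} (S : SelfSimilarGroup Γ A)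

/-- The letter `y` with `γ · x = y`. -/
noncomputable def letter (γ : Γ) (x : A) : A := (S.exists_restrict γ x).choose

/-- The element `γ|ₓ` with `γ · (x w) = y (γ|ₓ · w)`. -/
noncomputable def restrict (γ : Γ) (x : A) : Γ := (S.exists_restrict γ x).choose_spec.choose

theorem act_cons (γ : Γ) (x : A) (w : List A) :
    S.act γ (x :: w) = S.letter γ x :: S.act (S.restrict γ x) w :=
  (S.exists_restrict γ x).choose_spec.choose_spec w

theorem letter_restrict_unique {γ η : Γ} {x y : A}
    (h : ∀ w, S.act γ (x :: w) = y :: S.act η w) : S.letter γ x = y ∧ S.restrict γ x = η := by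
  have h' : ∀ w, S.letter γ x = y ∧ S.act (S.restrict γ x) w = S.act η w := fun w => by
    have := h w
    rw [act_cons] at this
    exact List.cons.inj this
  exact ⟨(h' []).1, S.faithful (Equiv.ext fun w => (h' w).2)⟩

theorem letter_restrict_mul (γ η : Γ) (x : A) :
    S.letter (γ * η) x = S.letter γ (S.letter η x) ∧
      S.restrict (γ * η) x = S.restrict γ (S.letter η x) * S.restrict η x :=
  S.letter_restrict_unique fun w => by
    rw [map_mul, map_mul, Equiv.Perm.mul_apply, Equiv.Perm.mul_apply, act_cons, act_cons]

theorem letter_restrict_one (x : A) : S.letter 1 x = x ∧ S.restrict 1 x = 1 :=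
  S.letter_restrict_unique fun w => by rw [map_one]; rfl

/-- The sequence `g₁ = γ`, `gₙ₊₁ = (gₙ)|_{xₙ}` (indices shifted by one) along `ξ = x₁ x₂ x₃ …`. -/
noncomputable def iter (γ : Γ) (ξ : ℕ → A) : ℕ → Γ
  | 0 => γ
  | n + 1 => S.restrict (iter γ ξ n) (ξ n)

/-- The action on infinite words: `γ · x₁ x₂ x₃ … = y₁ y₂ y₃ …`, where `gₙ · xₙ = yₙ`. -/
noncomputable def actInf (γ : Γ) (ξ : ℕ → A) : ℕ → A := fun n => S.letter (S.iter γ ξ n) (ξ n)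

theorem iter_cons (γ : Γ) (x : A) (ξ : ℕ → A) (n : ℕ) :
    S.iter γ (cons x ξ) (n + 1) = S.iter (S.restrict γ x) ξ n := by
  induction n with
  | zero => rfl
  | succ n ih =>
    change S.restrict (S.iter γ (cons x ξ) (n + 1)) _ = _
    rw [ih]; rfl

theorem actInf_cons (γ : Γ) (x : A) (ξ : ℕ → A) :
    S.actInf γ (cons x ξ) = cons (S.letter γ x) (S.actInf (S.restrict γ x) ξ) := by
  funext n
  cases n with
  | zero => rfl
  | succ n => exact congrArg (fun g => S.letter g (ξ n)) (S.iter_cons γ x ξ n)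

theorem iter_mul (γ η : Γ) (ξ : ℕ → A) (n : ℕ) :
    S.iter (γ * η) ξ n = S.iter γ (S.actInf η ξ) n * S.iter η ξ n := by
  induction n with
  | zero => rfl
  | succ n ih =>
    change S.restrict (S.iter (γ * η) ξ n) (ξ n) = _
    rw [ih, (S.letter_restrict_mul _ _ _).2]; rfl

theorem actInf_mul (γ η : Γ) (ξ : ℕ → A) :
    S.actInf (γ * η) ξ = S.actInf γ (S.actInf η ξ) := by
  funext n
  change S.letter (S.iter (γ * η) ξ n) (ξ n) = _
  rw [iter_mul, (S.letter_restrict_mul _ _ _).1]; rfl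

theorem iter_one (ξ : ℕ → A) (n : ℕ) : S.iter 1 ξ n = 1 := by
  induction n with
  | zero => rfl
  | succ n ih =>
    change S.restrict (S.iter 1 ξ n) (ξ n) = _
    rw [ih, (S.letter_restrict_one _).2]

theorem actInf_one (ξ : ℕ → A) : S.actInf 1 ξ = ξ := by
  funext n
  change S.letter (S.iter 1 ξ n) (ξ n) = _
  rw [iter_one, (S.letter_restrict_one _).1]

theorem actInf_inv_actInf (γ : Γ) (ξ : ℕ → A) : S.actInf γ⁻¹ (S.actInf γ ξ) = ξ := by
  rw [← actInf_mul, inv_mul_cancel, actInf_one]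

theorem actInf_actInf_inv (γ : Γ) (ξ : ℕ → A) : S.actInf γ (S.actInf γ⁻¹ ξ) = ξ := by
  rw [← actInf_mul, mul_inv_cancel, actInf_one]

theorem length_act (γ : Γ) (w : List A) : (S.act γ w).length = w.length := by
  induction w generalizing γ with
  | nil => rw [act_nil]
  | cons x w ih => rw [act_cons, List.length_cons, List.length_cons, ih]

theorem exists_actInf_prepend (γ : Γ) (w : List A) (ξ : ℕ → A) :
    ∃ ζ, S.actInf γ (prepend w ξ) = prepend (S.act γ w) ζ := by
  induction w generalizing γ with
  | nil => rw [act_nil]; exact ⟨_, rfl⟩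
  | cons x w ih =>
    obtain ⟨ζ, hζ⟩ := ih (S.restrict γ x)
    refine ⟨ζ, ?_⟩
    rw [act_cons]
    change S.actInf γ (cons x (prepend w ξ)) = cons _ (prepend _ ζ)
    rw [actInf_cons, hζ]

theorem eq_one_of_actInf [Nonempty A] {γ : Γ} (h : ∀ ξ, S.actInf γ ξ = ξ) : γ = 1 := by
  apply S.faithful
  ext1 w
  rw [map_one]
  obtain ⟨ζ, hζ⟩ := S.exists_actInf_prepend γ w fun _ => Classical.arbitrary A
  rw [h] at hζ
  exact (prepend_inj (S.length_act γ w).symm hζ).1.symm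

/-- `(Γ, A)` is pseudo-free if `γ · (x w) = x w` for all words `w` only for `γ = 1`. -/
def IsPseudoFree : Prop := ∀ γ x, (∀ w, S.act γ (x :: w) = x :: w) → γ = 1

theorem eq_one_of_fix [Nonempty A] (hS : S.IsPseudoFree) (w : List A) {γ : Γ}
    (h : ∀ ξ ∈ cylinder w, S.actInf γ ξ = ξ) : γ = 1 := by
  induction w generalizing γ with
  | nil => exact S.eq_one_of_actInf fun ξ => h ξ ⟨ξ, rfl⟩
  | cons x w ih =>
    have h' : ∀ ξ, S.letter γ x = x ∧ S.actInf (S.restrict γ x) (prepend w ξ) = prepend w ξ := by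
      intro ξ
      have := h (cons x (prepend w ξ)) ⟨ξ, rfl⟩
      rw [actInf_cons] at this
      exact cons_inj this
    have h1 : S.restrict γ x = 1 := ih (by rintro _ ⟨ξ, rfl⟩; exact (h' ξ).2)
    refine hS γ x fun v => ?_
    rw [act_cons, h1, (h' fun _ => x).1, map_one]; rfl

section Top

variable [TopologicalSpace A] [DiscreteTopology A]

theorem isLocallyConstant_iter (γ : Γ) (n : ℕ) :
    IsLocallyConstant fun ξ : ℕ → A => S.iter γ ξ n := by
  induction n with
  | zero => exact IsLocallyConstant.const γ
  | succ n ih =>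
    have h2 : IsLocallyConstant fun ξ : ℕ → A => ξ n :=
      (IsLocallyConstant.iff_continuous _).2 (continuous_apply n)
    exact ih.comp₂ h2 fun g x => S.restrict g x

theorem continuous_actInf (γ : Γ) : Continuous (S.actInf γ) := by
  refine continuous_pi fun n => ?_
  have h2 : IsLocallyConstant fun ξ : ℕ → A => ξ n :=
    (IsLocallyConstant.iff_continuous _).2 (continuous_apply n)
  exact ((S.isLocallyConstant_iter γ n).comp₂ h2 fun g x => S.letter g x).continuous

/-- The homeomorphism `S_(α, g, β) : Z(β) → Z(α)`, `β ξ ↦ α (g · ξ)`. -/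
noncomputable def localMap (α : List A) (g : Γ) (β : List A) :
    OpenPartialHomeomorph (ℕ → A) (ℕ → A) where
  toFun ξ := prepend α (S.actInf g (drop β.length ξ))
  invFun ξ := prepend β (S.actInf g⁻¹ (drop α.length ξ))
  source := cylinder β
  target := cylinder α
  map_source' _ _ := ⟨_, rfl⟩
  map_target' _ _ := ⟨_, rfl⟩
  left_inv' := by
    rintro _ ⟨ξ, rfl⟩
    rw [drop_prepend, drop_prepend, actInf_inv_actInf]
  right_inv' := by
    rintro _ ⟨ξ, rfl⟩
    rw [drop_prepend, drop_prepend, actInf_actInf_inv]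
  open_source := isOpen_cylinder β
  open_target := isOpen_cylinder α
  continuousOn_toFun := ((continuous_prepend α).comp
    ((S.continuous_actInf g).comp (continuous_drop _))).continuousOn
  continuousOn_invFun := ((continuous_prepend β).comp
    ((S.continuous_actInf g⁻¹).comp (continuous_drop _))).continuousOn

theorem localMap_prepend (α : List A) (g : Γ) (β : List A) (ξ : ℕ → A) :
    S.localMap α g β (prepend β ξ) = prepend α (S.actInf g ξ) := by
  change prepend α (S.actInf g (drop β.length (prepend β ξ))) = _
  rw [drop_prepend]

theorem localMap_refine (k : ℕ) (α : List A) (g : Γ) (β : List A) {ξ : ℕ → A}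
    (hξ : ξ ∈ cylinder β) : ∃ α' g' β', α'.length = α.length + k ∧ β'.length = β.length + k ∧
      ξ ∈ cylinder β' ∧ S.localMap α' g' β' =ᶠ[𝓝 ξ] S.localMap α g β := by
  induction k generalizing α g β with
  | zero => exact ⟨α, g, β, rfl, rfl, hξ, EventuallyEq.rfl⟩
  | succ k ih =>
    obtain ⟨ζ, rfl⟩ := hξ
    have hm : prepend β ζ ∈ cylinder (β ++ [ζ 0]) := by
      refine ⟨drop 1 ζ, ?_⟩
      rw [prepend_append]
      exact congrArg _ (cons_drop ζ)
    obtain ⟨α', g', β', h1, h2, h3, h4⟩ :=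
      ih (α ++ [S.letter g (ζ 0)]) (S.restrict g (ζ 0)) (β ++ [ζ 0]) hm
    refine ⟨α', g', β', ?_, ?_, h3, h4.trans ?_⟩
    · rw [h1, List.length_append, List.length_singleton]; omega
    · rw [h2, List.length_append, List.length_singleton]; omega
    · filter_upwards [(isOpen_cylinder _).mem_nhds hm]
      rintro _ ⟨θ, rfl⟩
      rw [localMap_prepend, prepend_append, prepend_append, localMap_prepend]
      change prepend α (cons _ _) = prepend α (S.actInf g (cons (ζ 0) θ))
      rw [actInf_cons]; rfl

/-- The local homeomorphisms `S_(α, g, β)` with `|α| = |β|`. -/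
noncomputable def kernelSystem : GermSystem (ℕ → A) where
  carrier := {φ | ∃ α g β, α.length = β.length ∧ φ = S.localMap α g β}
  exists_id ξ := by
    refine ⟨_, ⟨[], 1, [], rfl, rfl⟩, ⟨ξ, rfl⟩, Eventually.of_forall fun ζ => ?_⟩
    exact S.actInf_one ζ
  exists_symm := by
    rintro _ ⟨α, g, β, h, rfl⟩ ξ hξ
    exact ⟨_, ⟨β, g⁻¹, α, h.symm, rfl⟩, (S.localMap α g β).map_source hξ, EventuallyEq.rfl⟩
  exists_comp := by
    rintro _ ⟨γ, h, δ, hγδ, rfl⟩ _ ⟨α, g, β, hαβ, rfl⟩ ξ hξ hξ'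
    obtain ⟨α', g', β', a1, a2, a3, a4⟩ := S.localMap_refine δ.length α g β hξ
    obtain ⟨γ', h', δ', b1, b2, b3, b4⟩ := S.localMap_refine α.length γ h δ hξ'
    have e : α' = δ' := by
      refine cylinder_unique (by omega) ?_ b3
      rw [← a4.eq_of_nhds]
      exact (S.localMap α' g' β').map_source a3
    subst e
    refine ⟨_, ⟨γ', h' * g', β', by omega, rfl⟩, a3, ?_⟩
    filter_upwards [a4, ((S.localMap α g β).continuousAt hξ).eventually b4,
      (isOpen_cylinder β').mem_nhds a3] with ζ h1 h2 h3
    obtain ⟨θ, rfl⟩ := h3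
    change _ = S.localMap γ h δ (S.localMap α g β _)
    rw [← h2, ← h1, localMap_prepend, localMap_prepend, localMap_prepend, actInf_mul]

/-- The groupoid `ℋ_(Γ,A) = {[α, g, β; ξ] : |α| = |β|, ξ ∈ Z(β)}`, the kernel of the cocycle
`[α, g, β; ξ] ↦ |α| - |β|` on the groupoid of germs of all the maps `S_(α, g, β)`. -/
abbrev KernelGroupoid : Type _ := Germ S.kernelSystem

instance [Finite A] : IsAmple S.KernelGroupoid :=
  Germ.isAmple isTopologicalBasis_isClopen fun _ hU => hU.1.isCompact

theorem t2Space_kernelGroupoid [Nonempty A] (hS : S.IsPseudoFree) :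
    T2Space S.KernelGroupoid := by
  refine Germ.t2Space ?_
  rintro _ ⟨α, g, β, hαβ, rfl⟩ _ ⟨γ, h, δ, hγδ, rfl⟩ ξ hξ hξ' hf
  obtain ⟨α', g', β', a1, a2, a3, a4⟩ := S.localMap_refine δ.length α g β hξ
  obtain ⟨γ', h', δ', b1, b2, b3, b4⟩ := S.localMap_refine β.length γ h δ hξ'
  obtain rfl : β' = δ' := cylinder_unique (by omega) a3 b3
  obtain ⟨ζ, hζ, ha, hb, hζβ⟩ := (hf.and_eventually (a4.eventually_nhds.and
    (b4.eventually_nhds.and ((isOpen_cylinder β').mem_nhds a3)))).exists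
  obtain ⟨θ, rfl⟩ := hζβ
  have he : S.localMap α' g' β' =ᶠ[𝓝 (prepend β' θ)] S.localMap γ' h' β' :=
    EventuallyEq.trans ha (hζ.trans (EventuallyEq.symm hb))
  have he' := he.eq_of_nhds
  rw [localMap_prepend, localMap_prepend] at he'
  obtain ⟨rfl, -⟩ := prepend_inj (by omega) he'
  have hev := ((continuous_prepend β').continuousAt (x := θ)).eventually he
  obtain ⟨V, hV, hVo, hθ⟩ := eventually_nhds_iff.1 hev
  obtain ⟨w, -, hw⟩ := exists_cylinder_subset hVo hθ
  have h1 : h'⁻¹ * g' = 1 := by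
    refine S.eq_one_of_fix hS w fun η hη => ?_
    have h2 := hV η (hw hη)
    rw [localMap_prepend, localMap_prepend] at h2
    rw [actInf_mul, (prepend_inj rfl h2).2, actInf_inv_actInf]
  obtain rfl : h' = g' := inv_mul_eq_one.1 h1
  exact a4.symm.trans b4

end Top

end SelfSimilarGroup

/-! ### The self-similar infinite dihedral group -/

/-- The generators `a` and `b`. -/
inductive DihedralGen
  | a
  | b

/-- The infinite dihedral group `⟨a, b : a² = b² = 1⟩`. -/
abbrev InfiniteDihedral : Type :=
  PresentedGroup (range fun x : DihedralGen => FreeGroup.of x * FreeGroup.of x)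

namespace InfiniteDihedral

/-- The generator `a`. -/
def a : InfiniteDihedral := PresentedGroup.of DihedralGen.a

/-- The generator `b`. -/
def b : InfiniteDihedral := PresentedGroup.of DihedralGen.b

/-- `a · (0 w) = 1 w` and `a · (1 w) = 0 w`; the letters `0` and `1` are `false` and `true`. -/
def aFun : List Bool → List Bool
  | [] => []
  | false :: w => true :: w
  | true :: w => false :: w

/-- `b · (0 w) = 0 (a · w)` and `b · (1 w) = 1 (b · w)`. -/
def bFun : List Bool → List Bool
  | [] => []
  | false :: w => false :: aFun w
  | true :: w => true :: bFun w

theorem aFun_aFun : Function.Involutive aFun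
  | [] => rfl
  | false :: _ => rfl
  | true :: _ => rfl

theorem bFun_bFun : Function.Involutive bFun
  | [] => rfl
  | false :: w => congrArg (false :: ·) (aFun_aFun w)
  | true :: w => congrArg (true :: ·) (bFun_bFun w)

/-- The permutations of the set of words given by the generators. -/
def genPerm : DihedralGen → Equiv.Perm (List Bool)
  | .a => aFun_aFun.toPerm
  | .b => bFun_bFun.toPerm

theorem genPerm_rel : ∀ r ∈ range fun x : DihedralGen => FreeGroup.of x * FreeGroup.of x,
    FreeGroup.lift genPerm r = 1 := by
  rintro _ ⟨x, rfl⟩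
  change FreeGroup.lift genPerm (FreeGroup.of x * FreeGroup.of x) = 1
  rw [map_mul, FreeGroup.lift_apply_of]
  ext1 w
  cases x
  · exact aFun_aFun w
  · exact bFun_bFun w

/-- The action of the infinite dihedral group on finite words. -/
def actHom : InfiniteDihedral →* Equiv.Perm (List Bool) := PresentedGroup.toGroup genPerm_rel

theorem actHom_a (w : List Bool) : actHom a w = aFun w := by
  rw [actHom, a, PresentedGroup.toGroup.of]; rfl

theorem actHom_b (w : List Bool) : actHom b w = bFun w := by
  rw [actHom, b, PresentedGroup.toGroup.of]; rfl

theorem a_mul_a : a * a = 1 := PresentedGroup.one_of_mem (mem_range_self DihedralGen.a)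

theorem b_mul_b : b * b = 1 := PresentedGroup.one_of_mem (mem_range_self DihedralGen.b)

theorem a_inv : a⁻¹ = a := inv_eq_of_mul_eq_one_left a_mul_a

theorem b_inv : b⁻¹ = b := inv_eq_of_mul_eq_one_left b_mul_b

theorem induction {p : InfiniteDihedral → Prop} (h1 : p 1) (ha : p a) (hb : p b)
    (hmul : ∀ x y, p x → p y → p (x * y)) (hinv : ∀ x, p x → p x⁻¹) (γ : InfiniteDihedral) :
    p γ := by
  let H : Subgroup InfiniteDihedral :=
    { carrier := {x | p x}
      mul_mem' := fun {x y} hx hy => hmul x y hx hy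
      one_mem' := h1
      inv_mem' := fun {x} hx => hinv x hx }
  exact PresentedGroup.generated_by _ H (fun j => by cases j; exacts [ha, hb]) γ

theorem a_mul_zpow (n : ℤ) : a * (a * b) ^ n = (a * b) ^ (-n) * a := by
  have h : a * (a * b) * a⁻¹ = (a * b)⁻¹ := by
    rw [mul_inv_rev, a_inv, b_inv, ← mul_assoc, a_mul_a, one_mul]
  have h2 : a * (a * b) ^ n * a⁻¹ = (a * b) ^ (-n) := by
    rw [← conj_zpow, h, inv_zpow, zpow_neg]
  rw [← h2, inv_mul_cancel_right]

theorem normal_form (γ : InfiniteDihedral) :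
    ∃ n : ℤ, γ = (a * b) ^ n ∨ γ = (a * b) ^ n * a := by
  induction γ using induction with
  | h1 => exact ⟨0, Or.inl (zpow_zero _).symm⟩
  | ha => exact ⟨0, Or.inr (by rw [zpow_zero, one_mul])⟩
  | hb =>
    refine ⟨-1, Or.inr ?_⟩
    rw [← a_mul_zpow, zpow_one, ← mul_assoc, a_mul_a, one_mul]
  | hmul x y hx hy =>
    obtain ⟨n, rfl | rfl⟩ := hx <;> obtain ⟨m, rfl | rfl⟩ := hy
    · exact ⟨n + m, Or.inl (zpow_add _ _ _).symm⟩
    · exact ⟨n + m, Or.inr (by rw [zpow_add, mul_assoc])⟩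
    · exact ⟨n + -m, Or.inr (by rw [mul_assoc, a_mul_zpow, zpow_add, mul_assoc])⟩
    · refine ⟨n + -m, Or.inl ?_⟩
      rw [mul_assoc, ← mul_assoc a, a_mul_zpow, mul_assoc _ a a, a_mul_a, mul_one, zpow_add]
  | hinv x hx =>
    obtain ⟨n, rfl | rfl⟩ := hx
    · exact ⟨-n, Or.inl (zpow_neg _ _).symm⟩
    · exact ⟨n, Or.inr (by rw [mul_inv_rev, a_inv, ← zpow_neg, a_mul_zpow, neg_neg])⟩

theorem act_mul (x y : InfiniteDihedral) (w : List Bool) :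
    actHom (x * y) w = actHom x (actHom y w) := by
  rw [map_mul]; rfl

theorem act_sq_true (m : ℤ) (w : List Bool) :
    actHom ((a * b) ^ (2 * m)) (true :: w) = true :: actHom ((a * b) ^ m) w := by
  have h : ∀ w, actHom ((a * b) ^ (2 : ℤ)) (true :: w) = true :: actHom (a * b) w := by
    intro w
    rw [zpow_two, act_mul, act_mul, act_mul, act_mul]
    simp only [actHom_a, actHom_b]; rfl
  induction m generalizing w with
  | zero => simp
  | succ m ih =>
    rw [mul_add, mul_one, zpow_add, act_mul, h, ih, zpow_add_one, act_mul ((a * b) ^ (m : ℤ))]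
  | pred m ih =>
    have h' : ∀ w, actHom ((a * b) ^ (-2 : ℤ)) (true :: w) = true :: actHom (a * b)⁻¹ w := by
      intro w
      rw [zpow_neg, map_inv, Equiv.Perm.inv_eq_iff_eq, h, ← act_mul, mul_inv_cancel, map_one]
      rfl
    rw [show 2 * (-(m : ℤ) - 1) = 2 * (-m) + -2 by ring, zpow_add, act_mul, h', ih,
      zpow_sub_one, act_mul]

theorem act_sq_false (m : ℤ) (w : List Bool) :
    actHom ((a * b) ^ (2 * m)) (false :: w) = false :: actHom ((a * b) ^ (-m)) w := by
  have h : ∀ w, actHom a (false :: w) = true :: w := fun w => actHom_a _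
  have h' : ∀ w, actHom a (true :: w) = false :: w := fun w => actHom_a _
  have e : (a * b) ^ (2 * m) = a * (a * b) ^ (2 * -m) * a := by
    rw [a_mul_zpow, mul_assoc, a_mul_a, mul_one, mul_neg, neg_neg]
  rw [e, act_mul, act_mul, h, act_sq_true, h']

theorem act_odd (m : ℤ) (x : Bool) (w : List Bool) :
    actHom ((a * b) ^ (2 * m + 1)) (x :: w) =
      (!x) :: actHom ((a * b) ^ (if x then -m else m)) (actHom (if x then b else a) w) := by
  rw [zpow_add_one, act_mul, act_mul, actHom_b, actHom_a]
  cases x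
  · change actHom ((a * b) ^ (2 * m)) (true :: aFun w) = _
    rw [act_sq_true, ← actHom_a]; rfl
  · change actHom ((a * b) ^ (2 * m)) (false :: bFun w) = _
    rw [act_sq_false, ← actHom_b]; rfl

theorem not_act_zpow_a (n : ℤ) : actHom ((a * b) ^ n * a) ≠ 1 := by
  intro h
  obtain ⟨m, rfl | rfl⟩ := Int.even_or_odd' n
  · have h1 := Equiv.congr_fun h [false]
    rw [act_mul, actHom_a] at h1
    change actHom ((a * b) ^ (2 * m)) (true :: []) = false :: [] at h1
    rw [act_sq_true] at h1
    simp at h1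
  · have e : (a * b) ^ (2 * m + 1) * a = ((a * b) ^ m * a) * b * ((a * b) ^ m * a)⁻¹ := by
      rw [mul_inv_rev, a_inv, ← zpow_neg, a_mul_zpow, neg_neg, two_mul, add_assoc,
        zpow_add, add_comm m 1, zpow_one_add]
      simp only [mul_assoc]
    rw [e, map_mul, map_mul, map_inv, mul_inv_eq_one] at h
    have h2 : actHom b = 1 := mul_eq_left.1 h
    have h1 := Equiv.congr_fun h2 [false, false]
    rw [actHom_b] at h1
    exact absurd h1 (by decide)

theorem act_zpow_eq_one {n : ℤ} (h : actHom ((a * b) ^ n) = 1) : n = 0 := by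
  induction hk : n.natAbs using Nat.strong_induction_on generalizing n with
  | _ k ih =>
  obtain ⟨m, rfl | rfl⟩ := Int.even_or_odd' n
  · by_contra hne
    have : m = 0 := by
      refine ih m.natAbs (by omega) (Equiv.ext fun w => ?_) rfl
      have h1 := Equiv.congr_fun h (true :: w)
      rw [act_sq_true] at h1
      exact (List.cons.inj h1).2
    omega
  · exfalso
    have h1 := Equiv.congr_fun h [true]
    rw [act_odd] at h1
    exact absurd (List.cons.inj h1).1 (by decide)

theorem exists_restrict (γ : InfiniteDihedral) :
    ∀ x, ∃ y η, ∀ w, actHom γ (x :: w) = y :: actHom η w := by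
  have key : (∀ x, ∃ y η, ∀ w, actHom γ (x :: w) = y :: actHom η w) ∧
      ∀ x, ∃ y η, ∀ w, actHom γ⁻¹ (x :: w) = y :: actHom η w := by
    have hmul : ∀ γ γ' : InfiniteDihedral,
        (∀ x, ∃ y η, ∀ w, actHom γ (x :: w) = y :: actHom η w) →
        (∀ x, ∃ y η, ∀ w, actHom γ' (x :: w) = y :: actHom η w) →
        ∀ x, ∃ y η, ∀ w, actHom (γ * γ') (x :: w) = y :: actHom η w := by
      intro γ γ' h h' x
      obtain ⟨y, η, hy⟩ := h' x
      obtain ⟨z, θ, hz⟩ := h y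
      exact ⟨z, θ * η, fun w => by rw [act_mul, hy, hz, act_mul]⟩
    have ha : ∀ x, ∃ y η, ∀ w, actHom a (x :: w) = y :: actHom η w := by
      intro x
      refine ⟨!x, 1, fun w => ?_⟩
      rw [actHom_a, map_one]
      cases x <;> rfl
    have hb : ∀ x, ∃ y η, ∀ w, actHom b (x :: w) = y :: actHom η w := by
      intro x
      cases x
      · exact ⟨false, a, fun w => by rw [actHom_b, actHom_a]; rfl⟩
      · exact ⟨true, b, fun w => by rw [actHom_b, actHom_b]; rfl⟩
    have h1 : ∀ x, ∃ y η, ∀ w, actHom 1 (x :: w) = y :: actHom η w :=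
      fun x => ⟨x, 1, fun w => by rw [map_one]; rfl⟩
    induction γ using induction with
    | h1 => exact ⟨h1, by rwa [inv_one]⟩
    | ha => exact ⟨ha, by rwa [a_inv]⟩
    | hb => exact ⟨hb, by rwa [b_inv]⟩
    | hmul x y hx hy => exact ⟨hmul _ _ hx.1 hy.1, by rw [mul_inv_rev]; exact hmul _ _ hy.2 hx.2⟩
    | hinv x hx => exact ⟨hx.2, by rw [inv_inv]; exact hx.1⟩
  exact key.1

/-- The self-similar infinite dihedral group `(Γ, {0, 1})`. -/
def selfSimilar : SelfSimilarGroup InfiniteDihedral Bool where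
  act := actHom
  faithful := by
    rw [injective_iff_map_eq_one]
    intro γ h
    obtain ⟨n, rfl | rfl⟩ := normal_form γ
    · rw [act_zpow_eq_one h, zpow_zero]
    · exact absurd h (not_act_zpow_a n)
  act_nil γ := by
    induction γ using induction with
    | h1 => rw [map_one]; rfl
    | ha => rw [actHom_a]; rfl
    | hb => rw [actHom_b]; rfl
    | hmul x y hx hy => rw [act_mul, hy, hx]
    | hinv x hx => rw [map_inv, Equiv.Perm.inv_eq_iff_eq, hx]
  exists_restrict := exists_restrict

theorem isPseudoFree : selfSimilar.IsPseudoFree := by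
  intro γ x h
  change ∀ w, actHom γ (x :: w) = x :: w at h
  obtain ⟨n, rfl | rfl⟩ := normal_form γ <;> obtain ⟨m, rfl | rfl⟩ := Int.even_or_odd' n
  · have : m = 0 := by
      cases x
      · have h1 : actHom ((a * b) ^ (-m)) = 1 := Equiv.ext fun w => by
          have h2 := h w
          rw [act_sq_false] at h2
          exact (List.cons.inj h2).2
        exact neg_eq_zero.1 (act_zpow_eq_one h1)
      · refine act_zpow_eq_one (Equiv.ext fun w => ?_)
        have h2 := h w
        rw [act_sq_true] at h2
        exact (List.cons.inj h2).2
    rw [this, mul_zero, zpow_zero]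
  · have h1 := h []
    rw [act_odd] at h1
    exact absurd (List.cons.inj h1).1 (by cases x <;> decide)
  · exfalso
    have h1 := h []
    rw [act_mul, actHom_a] at h1
    cases x
    · change actHom ((a * b) ^ (2 * m)) (true :: []) = false :: [] at h1
      rw [act_sq_true] at h1
      exact absurd (List.cons.inj h1).1 (by decide)
    · change actHom ((a * b) ^ (2 * m)) (false :: []) = true :: [] at h1
      rw [act_sq_false] at h1
      exact absurd (List.cons.inj h1).1 (by decide)
  · exfalso
    cases x
    · apply not_act_zpow_a (-m - 1)
      refine Equiv.ext fun w => ?_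
      have h1 := h w
      rw [zpow_add_one, act_mul, act_mul, act_mul, actHom_a, actHom_b, actHom_a] at h1
      change actHom ((a * b) ^ (2 * m)) (false :: bFun w) = false :: w at h1
      rw [act_sq_false, ← actHom_b, ← act_mul] at h1
      have e : (a * b) ^ (-m - 1) * a = (a * b) ^ (-m) * b := by
        rw [zpow_sub_one, mul_inv_rev, a_inv, b_inv, mul_assoc, mul_assoc, a_mul_a, mul_one]
      rw [e]
      exact (List.cons.inj h1).2
    · apply not_act_zpow_a m
      refine Equiv.ext fun w => ?_
      have h1 := h w
      rw [zpow_add_one, act_mul, act_mul, act_mul, actHom_a, actHom_b, actHom_a] at h1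
      change actHom ((a * b) ^ (2 * m)) (true :: aFun w) = true :: w at h1
      rw [act_sq_true, ← actHom_a, ← act_mul] at h1
      exact (List.cons.inj h1).2

instance : T2Space selfSimilar.KernelGroupoid := selfSimilar.t2Space_kernelGroupoid isPseudoFree

end InfiniteDihedral

end TRGroupoid

namespace TRGroupoid

open Set Filter Topology CompactlySupported

/-! ### Compact bisections and the boundary map -/

section Transpositions

open TopGroupoid

variable {G : Type*} {X : Type*} [TopologicalSpace G] [TopologicalSpace X] [TopGroupoid G X]

/-! Write `T` for the group generated by the transpositions and `I` for the index map. The inclusion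
of `T` in the kernel of `I` holds for every effective Hausdorff ample groupoid with compact unit
space: the indicator of `hat U` is an explicit boundary (`homClass_hat`). For the other inclusion it
is enough that the full group modulo `T` has at most two elements and that `I` detects the possible
nontrivial one.

Upper bound. By compactness every element of the full group is a table `w ξ ↦ σ(w) (g_w · ξ)` over
the words `w` of one length `n` (`exists_eq_fullTable`). The permutation part is a product of swaps
of cylinders, hence lies in `T`. The letter `a` placed at a word `w` swaps the cylinders of `w0` and
`w1`, so it lies in `T` as well (`diagHom_a_mem`). The letter `b` placed at `w` equals `a` at `w0`
times `b` at `w1` (`diagHom_b_eq`), and modulo `T` a group element can be moved from one word to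
another of the same length (`diagHom_mulSingle_div_mem`). Hence `b` at any word is congruent to `b`
at the empty word, which is the involution `fullB`. Since `T` is normal, every element is a power of
`fullB` times an element of `T`.

Lower bound. Let `ψ` be the homomorphism to `ℤ/2` with `a ↦ 0` and `b ↦ 1`. It satisfies `ψ(g) = ∑ₓ
ψ(g|ₓ)`, because `a` restricts to `1, 1` and `b` restricts to `a, b`. Hence giving the bisection of
`(α, g, β)` the value `ψ(g)` is compatible with subdividing the bisection, and additivity of `ψ`
makes the resulting functional vanish on boundaries. In the formal proof this functional is
`levelSum` at a sufficiently deep level. It takes the value `1` on the bisection of `fullB`, so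
`I(fullB)` is nontrivial (`indexMap_fullB_ne_one`), and an element of the kernel of `I` involves an
even power of `fullB`. -/

theorem IsBisection.inv {U : Set G} (hU : IsBisection U) : IsBisection (inv '' U) where
  isOpen := isOpen_inv_image hU.isOpen
  injOn_s := by
    rintro _ ⟨a, ha, rfl⟩ _ ⟨b, hb, rfl⟩ he
    rw [s_inv, s_inv] at he
    rw [hU.injOn_r ha hb he]
  injOn_r := by
    rintro _ ⟨a, ha, rfl⟩ _ ⟨b, hb, rfl⟩ he
    rw [r_inv, r_inv] at he
    rw [hU.injOn_s ha hb he]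

theorem image_s_inv (U : Set G) : (s '' (inv '' U) : Set X) = r '' U := by
  rw [image_image]
  exact image_congr fun a _ => s_inv a

theorem image_r_inv (U : Set G) : (r '' (inv '' U) : Set X) = s '' U := by
  rw [image_image]
  exact image_congr fun a _ => r_inv a

theorem image_s_one (D : Set X) : (s '' (one '' D : Set G) : Set X) = D := by
  rw [image_image]
  simp only [s_one, image_id']

theorem image_r_one (D : Set X) : (r '' (one '' D : Set G) : Set X) = D := by
  rw [image_image]
  simp only [r_one, image_id']

theorem isBisection_one_image [IsAmple G] {D : Set X} (hD : IsOpen D) :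
    IsBisection (one '' D : Set G) where
  isOpen := by
    -- Openness comes from the units forming an open set in an étale groupoid.
    have : (one '' D : Set G) = range one ∩ s ⁻¹' D := by
      ext g
      constructor
      · rintro ⟨x, hx, rfl⟩
        exact ⟨⟨x, rfl⟩, by rwa [mem_preimage, s_one]⟩
      · rintro ⟨⟨x, rfl⟩, hx⟩
        rw [mem_preimage, s_one] at hx
        exact ⟨x, hx, rfl⟩
    rw [this]
    exact isOpen_range_one.inter (hD.preimage continuous_s)
  injOn_s := isFullBisection_range_one.injOn_s.mono (image_subset_range _ _)
  injOn_r := isFullBisection_range_one.injOn_r.mono (image_subset_range _ _)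

theorem setMul_inv (U : Set G) (hU : InjOn (s : G → X) U) :
    setMul U (inv '' U) = one '' (r '' U : Set X) := by
  ext g
  constructor
  · rintro ⟨a, ha, _, ⟨b, hb, rfl⟩, hab, rfl⟩
    obtain rfl : a = b := hU ha hb (by rw [hab, r_inv])
    exact ⟨_, ⟨a, ha, rfl⟩, (mul_inv a hab).symm⟩
  · rintro ⟨_, ⟨a, ha, rfl⟩, rfl⟩
    exact ⟨a, ha, _, ⟨a, ha, rfl⟩, (r_inv a).symm, mul_inv a _⟩

theorem setMul_one_one (D : Set X) : setMul (one '' D : Set G) (one '' D) = one '' D := by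
  ext g
  constructor
  · rintro ⟨_, ⟨x, hx, rfl⟩, _, ⟨y, hy, rfl⟩, h, rfl⟩
    rw [TopGroupoid.mul_one]
    exact ⟨x, hx, rfl⟩
  · rintro ⟨x, hx, rfl⟩
    exact ⟨_, ⟨x, hx, rfl⟩, _, ⟨x, hx, rfl⟩, by rw [s_one, r_one], mul_one _ _ _⟩

theorem isCompact_setPair [T2Space X] {U V : Set G} (hU : IsCompact U) (hV : IsCompact V) :
    IsCompact (setPair U V) := by
  have hcl : IsClosedEmbedding (Subtype.val : Composable G → G × G) :=
    (isClosed_eq (continuous_s.comp continuous_fst)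
      (continuous_r.comp continuous_snd)).isClosedEmbedding_subtypeVal
  exact hcl.isCompact_preimage (hU.prod hV)

/-- `δ₂ 1_{(U × V) ∩ G⁽²⁾} = 1_V - 1_{UV} + 1_U` for compact bisections with `s(U) = r(V)`. -/
theorem delta₂_indicator_setPair [IsAmple G] [T2Space G] [T2Space X] {U V : Set G}
    (hU : IsBisection U) (hV : IsBisection V) (hUV : (s '' U : Set X) = r '' V)
    (hWo : IsOpen (setPair U V)) (hWc : IsCompact (setPair U V)) (g : G) :
    delta₂ G (indicatorCc (setPair U V) hWo hWc) g =
      V.indicator (fun _ => 1) g - (setMul U V).indicator (fun _ => 1) g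
        + U.indicator (fun _ => 1) g := by
  have i0 : InjOn (fun p : Composable G => p.1.2) (setPair U V) := by
    intro p hp q hq he
    refine Subtype.ext (Prod.ext (hU.injOn_s hp.1 hq.1 ?_) he)
    rw [p.2, q.2]; exact congrArg r he
  have i2 : InjOn (fun p : Composable G => p.1.1) (setPair U V) := by
    intro p hp q hq he
    refine Subtype.ext (Prod.ext he (hV.injOn_r hp.2 hq.2 ?_))
    rw [← p.2, ← q.2]; exact congrArg s he
  have i1 : InjOn (fun p : Composable G => mul p.1.1 p.1.2 p.2) (setPair U V) := by
    intro p hp q hq he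
    refine i0 hp hq (hV.injOn_s hp.2 hq.2 ?_)
    rw [← s_mul _ _ p.2, ← s_mul _ _ q.2]; exact congrArg s he
  -- The condition `s(U) = r(V)` enters only here and in `e2`: every element of either factor has a
  -- partner in the other.
  have e0 : (fun p : Composable G => p.1.2) '' setPair U V = V := by
    refine subset_antisymm (image_subset_iff.2 fun p hp => hp.2) fun b hb => ?_
    obtain ⟨a, ha, hab⟩ := hUV.symm ▸ mem_image_of_mem r hb
    exact ⟨⟨(a, b), hab⟩, ⟨ha, hb⟩, rfl⟩
  have e2 : (fun p : Composable G => p.1.1) '' setPair U V = U := by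
    refine subset_antisymm (image_subset_iff.2 fun p hp => hp.1) fun a ha => ?_
    obtain ⟨b, hb, hab⟩ := hUV ▸ mem_image_of_mem s ha
    exact ⟨⟨(a, b), hab.symm⟩, ⟨ha, hb⟩, rfl⟩
  change pushforward (fun p : Composable G => p.1.2) isLocalHomeomorph_snd _ g
      - pushforward (fun p : Composable G => mul p.1.1 p.1.2 p.2) isLocalHomeomorph_mul _ g
      + pushforward (fun p : Composable G => p.1.1) isLocalHomeomorph_fst _ g = _
  rw [pushforward_indicator_apply _ _ _ _ _ i0, pushforward_indicator_apply _ _ _ _ _ i1,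
    pushforward_indicator_apply _ _ _ _ _ i2, e0, e2, image_mul_setPair]

/-- With its converse `IsTransposition.exists_isClopen`, this describes transpositions by their
action on the unit space alone. The bisection is the part of the full bisection of `τ` with source
in `A`. -/
theorem isTransposition_of_involutive [IsAmple G] [CompactSpace X] {τ : FullGroup G}
    {A : Set X} (hA : IsClopen A)
    (hd : Disjoint (τ.1 '' A) A) (h2 : ∀ x ∈ A, τ.1 (τ.1 x) = x)
    (h1 : ∀ x, x ∉ A → x ∉ τ.1 '' A → τ.1 x = x) : IsTransposition τ := by
  obtain ⟨V, hV, hp⟩ := τ.2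
  have hs : (s '' (V ∩ s ⁻¹' A) : Set X) = A := by
    ext x
    constructor
    · rintro ⟨g, hg, rfl⟩
      exact hg.2
    · intro hx
      obtain ⟨g, hg, rfl⟩ := hV.image_s.symm ▸ mem_univ x
      exact ⟨g, ⟨hg, hx⟩, rfl⟩
  have hr : (r '' (V ∩ s ⁻¹' A) : Set X) = τ.1 '' A := by
    rw [← hs, image_image, hs]
    exact image_congr fun g hg => (hp g hg.1).symm
  refine ⟨V ∩ s ⁻¹' A, ⟨hV.isOpen.inter (hA.2.preimage continuous_s),
    hV.injOn_s.mono inter_subset_left, hV.injOn_r.mono inter_subset_left⟩,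
    hV.isCompact.inter_right (hA.1.preimage continuous_s), by rwa [hs, hr], ?_⟩
  rintro _ ((hg | ⟨g, hg, rfl⟩) | ⟨x, hx, rfl⟩)
  · exact hp _ hg.1
  · rw [s_inv, r_inv, ← hp g hg.1]
    exact h2 _ hg.2
  · rw [hs, hr] at hx
    rw [s_one, r_one]
    exact h1 x (fun h => hx (Or.inr h)) fun h => hx (Or.inl h)

theorem IsTransposition.exists_isClopen [IsAmple G] [T2Space X] {τ : FullGroup G}
    (hτ : IsTransposition τ) :
    ∃ A : Set X, IsClopen A ∧ Disjoint (τ.1 '' A) A ∧ (∀ x ∈ A, τ.1 (τ.1 x) = x) ∧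
      ∀ x, x ∉ A → x ∉ τ.1 '' A → τ.1 x = x := by
  obtain ⟨U, hU, hc, hd, hp⟩ := hτ
  have hr : τ.1 '' (s '' U) = r '' U := by
    rw [image_image]
    exact image_congr fun g hg => hp g (Or.inl (Or.inl hg))
  refine ⟨s '' U, ⟨(hc.image continuous_s).isClosed,
    (IsAmple.isLocalHomeomorph_s (G := G) (X := X)).isOpenMap _ hU.isOpen⟩, by rwa [hr], ?_, ?_⟩
  · rintro _ ⟨g, hg, rfl⟩
    rw [hp g (Or.inl (Or.inl hg)), ← s_inv g, hp _ (Or.inl (Or.inr ⟨g, hg, rfl⟩)), r_inv]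
  · intro x h1 h2
    rw [hr] at h2
    have := hp (one x) (Or.inr ⟨x, fun h => h.elim h2 h1, rfl⟩)
    rwa [s_one, r_one] at this

/-- Conjugating by `κ` replaces the clopen set `A` of the dynamical description by `κ(A)`, so
conjugates of transpositions are transpositions. -/
instance [IsAmple G] [T2Space X] [CompactSpace X] : (transpositionSubgroup G).Normal := by
  have h : ∀ (κ : FullGroup G), ∀ τ, IsTransposition τ → IsTransposition (κ * τ * κ⁻¹) := by
    intro κ τ hτ
    obtain ⟨A, hA, hd, h2, h1⟩ := hτ.exists_isClopen
    have hk : ∀ x, (κ * τ * κ⁻¹).1 (κ.1 x) = κ.1 (τ.1 x) := fun x =>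
      congrArg (fun y => κ.1 (τ.1 y)) (κ.1.symm_apply_apply x)
    have him : (κ * τ * κ⁻¹).1 '' (κ.1 '' A) = κ.1 '' (τ.1 '' A) := by
      rw [image_image, image_image]
      exact image_congr fun x _ => hk x
    refine isTransposition_of_involutive (A := κ.1 '' A)
      ⟨κ.1.isClosedMap _ hA.1, κ.1.isOpenMap _ hA.2⟩ ?_ ?_ ?_
    · rw [him]
      exact (disjoint_image_iff κ.1.injective).2 hd
    · rintro _ ⟨x, hx, rfl⟩
      rw [hk, hk, h2 x hx]
    · intro y h3 h4
      obtain ⟨x, rfl⟩ := κ.1.surjective y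
      rw [him] at h4
      rw [hk, h1 x (fun h => h3 ⟨x, h, rfl⟩) fun h => h4 ⟨_, h, rfl⟩]
  refine ⟨fun τ hτ κ => ?_⟩
  change τ ∈ Subgroup.closure _ at hτ
  induction hτ using Subgroup.closure_induction with
  | mem τ hτ => exact Subgroup.subset_closure (h κ τ hτ)
  | one => rw [_root_.mul_one, mul_inv_cancel]; exact one_mem _
  | mul x y _ _ hx hy =>
    have := mul_mem hx hy
    rwa [show κ * x * κ⁻¹ * (κ * y * κ⁻¹) = κ * (x * y) * κ⁻¹ by group] at this
  | inv x _ hx =>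
    have := inv_mem hx
    rwa [show (κ * x * κ⁻¹)⁻¹ = κ * x⁻¹ * κ⁻¹ by group] at this

theorem isFullBisection_hat [IsAmple G] [T2Space X] {U : Set G} (hU : IsBisection U)
    (hc : IsCompact U) (hd : Disjoint (r '' U : Set X) (s '' U)) : IsFullBisection (hat U) := by
  have hC : IsOpen ((r '' U ∪ s '' U : Set X)ᶜ) :=
    ((hc.image continuous_r).union (hc.image continuous_s)).isClosed.isOpen_compl
  have hC' := isBisection_one_image (G := G) hC
  have hs : (s '' (U ∪ inv '' U) : Set X) = r '' U ∪ s '' U := by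
    rw [image_union, image_s_inv, union_comm]
  have hr : (r '' (U ∪ inv '' U) : Set X) = r '' U ∪ s '' U := by
    rw [image_union, image_r_inv]
  -- The sources of `U` and `U⁻¹` are `s(U)` and `r(U)`, so disjointness of these two sets rules out
  -- the mixed cases.
  have his : InjOn (s : G → X) (U ∪ inv '' U) := by
    rintro a (ha | ha) b (hb | hb) he
    · exact hU.injOn_s ha hb he
    · exact absurd ⟨a, ha, rfl⟩ (disjoint_left.1 hd (by rw [he, ← image_s_inv]; exact ⟨b, hb, rfl⟩))
    · exact absurd ⟨b, hb, rfl⟩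
        (disjoint_left.1 hd (by rw [← he, ← image_s_inv]; exact ⟨a, ha, rfl⟩))
    · exact hU.inv.injOn_s ha hb he
  have hir : InjOn (r : G → X) (U ∪ inv '' U) := by
    rintro a (ha | ha) b (hb | hb) he
    · exact hU.injOn_r ha hb he
    · exact absurd ⟨a, ha, rfl⟩
        (disjoint_right.1 hd (by rw [he, ← image_r_inv]; exact ⟨b, hb, rfl⟩))
    · exact absurd ⟨b, hb, rfl⟩
        (disjoint_right.1 hd (by rw [← he, ← image_r_inv]; exact ⟨a, ha, rfl⟩))
    · exact hU.inv.injOn_r ha hb he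
  -- One argument for source and range: the images of `U ∪ U⁻¹` and of the remaining units are
  -- complementary.
  have glue : ∀ p : G → X, p '' (U ∪ inv '' U) = r '' U ∪ s '' U →
      p '' (one '' (r '' U ∪ s '' U : Set X)ᶜ) = (r '' U ∪ s '' U : Set X)ᶜ →
      InjOn p (U ∪ inv '' U) → InjOn p (one '' (r '' U ∪ s '' U : Set X)ᶜ) →
      InjOn p (hat U) ∧ p '' hat U = univ := by
    intro p h1 h2 h3 h4
    refine ⟨?_, by rw [hat, image_union, h1, h2, union_compl_self]⟩
    rintro a (ha | ha) b (hb | hb) he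
    · exact h3 ha hb he
    · have e1 := h1 ▸ mem_image_of_mem p ha
      have e2 := h2 ▸ mem_image_of_mem p hb
      exact absurd (he ▸ e1) e2
    · have e1 := h1 ▸ mem_image_of_mem p hb
      have e2 := h2 ▸ mem_image_of_mem p ha
      exact absurd (he ▸ e1) e2
    · exact h4 ha hb he
  have gs := glue s hs (image_s_one _) his hC'.injOn_s
  have gr := glue r hr (image_r_one _) hir hC'.injOn_r
  exact ⟨⟨(hU.isOpen.union hU.inv.isOpen).union hC'.isOpen, gs.1, gr.1⟩, gs.2, gr.2⟩

/-! ### Transpositions have index zero. -/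

section Index

variable [IsAmple G] [T2Space G] [T2Space X] [CompactSpace X]

theorem homClass_hat {U : Set G} (hU : IsBisection U) (hc : IsCompact U)
    (hd : Disjoint (r '' U : Set X) (s '' U)) (hf : IsFullBisection (hat U)) :
    hf.homClass = 0 := by
  have hrc : IsCompact (r '' U : Set X) := hc.image continuous_r
  have hro : IsOpen (r '' U : Set X) :=
    (IsAmple.isLocalHomeomorph_r (G := G) (X := X)).isOpenMap _ hU.isOpen
  have hso : IsOpen (s '' U : Set X) :=
    (IsAmple.isLocalHomeomorph_s (G := G) (X := X)).isOpenMap _ hU.isOpen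
  have hC : IsOpen ((r '' U ∪ s '' U : Set X)ᶜ) :=
    (hrc.union (hc.image continuous_s)).isClosed.isOpen_compl
  have hCc : IsCompact ((r '' U ∪ s '' U : Set X)ᶜ) :=
    (hro.union hso).isClosed_compl.isCompact
  set C := (r '' U ∪ s '' U : Set X)ᶜ with hCdef
  have hDo : IsOpen (r '' U ∪ C) := hro.union hC
  have hDc : IsCompact (one '' (r '' U ∪ C) : Set G) := (hrc.union hCc).image continuous_one
  have hDb := isBisection_one_image (G := G) hDo
  rw [IsFullBisection.homClass, QuotientAddGroup.eq_zero_iff, AddSubgroup.mem_addSubgroupOf]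
  -- With `C` the complement of `r(U) ∪ s(U)`, the first pair set has boundary `1_{U⁻¹} - 1_{r(U)} +
  -- 1_U`. For a set `D` of units, `D × D` has boundary `1_D`. Taking `D = r(U) ∪ C` cancels the
  -- term `-1_{r(U)}` and supplies the missing `1_C`.
  refine ⟨indicatorCc (setPair U (inv '' U)) (isOpen_setPair hU.isOpen hU.inv.isOpen)
      (isCompact_setPair hc (hc.image TopGroupoid.continuous_inv)) +
    indicatorCc (setPair (one '' (r '' U ∪ C)) (one '' (r '' U ∪ C)))
      (isOpen_setPair hDb.isOpen hDb.isOpen) (isCompact_setPair hDc hDc), ?_⟩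
  rw [map_add]
  ext g
  change delta₂ G _ g + delta₂ G _ g = (hat U).indicator (fun _ => (1 : ℤ)) g
  rw [delta₂_indicator_setPair hU hU.inv (image_r_inv U).symm,
    delta₂_indicator_setPair hDb hDb (by rw [image_s_one, image_r_one]),
    setMul_inv U hU.injOn_s, setMul_one_one, image_union]
  have d1 : Disjoint U (inv '' U) := disjoint_left.2 fun x h1 h2 =>
    disjoint_right.1 hd ⟨x, h1, rfl⟩ (by rw [← image_s_inv]; exact ⟨x, h2, rfl⟩)
  have d2 : Disjoint (U ∪ inv '' U) (one '' C) := by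
    rw [disjoint_left]
    rintro _ h ⟨x, hx, rfl⟩
    apply hx
    have := mem_image_of_mem (s : G → X) h
    rwa [image_union, image_s_inv, s_one, union_comm] at this
  have d3 : Disjoint (one '' (r '' U : Set X) : Set G) (one '' C) := by
    rw [disjoint_left]
    rintro _ ⟨y, hy, rfl⟩ ⟨x, hx, he⟩
    have : x = y := by rw [← s_one (G := G) x, he, s_one]
    subst this
    exact hx (Or.inl hy)
  rw [hat, indicator_union_of_disjoint d2, indicator_union_of_disjoint d1,
    indicator_union_of_disjoint d3]
  ring

theorem transpositionSubgroup_le_ker [IsEffective G] :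
    transpositionSubgroup G ≤ (indexMap G).ker := by
  rw [transpositionSubgroup, Subgroup.closure_le]
  rintro τ ⟨U, hU, hc, hd, hp⟩
  have hf := isFullBisection_hat hU hc hd
  rw [SetLike.mem_coe, MonoidHom.mem_ker, indexMap_eq G τ hf hp, homClass_hat hU hc hd, ofAdd_zero]

end Index

end Transpositions


/-! ### The full group of a groupoid of germs -/

section Germs

open TopGroupoid

variable {X : Type*} [TopologicalSpace X] {P : GermSystem X}

/-- A homeomorphism lies in the full group exactly when it is locally given by the maps of the germ
system; the full bisection is then the set of its own germs. This turns membership into a local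
condition that can be checked on cylinders. -/
theorem Germ.mem_fullGroup_iff [IsAmple (Germ P)] {h : X ≃ₜ X} :
    h ∈ FullGroup (Germ P) ↔ ∀ x, ∃ φ ∈ P.carrier, x ∈ φ.source ∧ h =ᶠ[𝓝 x] φ := by
  constructor
  · rintro ⟨U, hU, hp⟩ x
    obtain ⟨g, hg, rfl⟩ := hU.image_s.symm ▸ mem_univ x
    obtain ⟨φ, hφ, x, hx, rfl⟩ := Germ.exists_rep g
    refine ⟨φ, hφ, hx, ?_⟩
    change h =ᶠ[𝓝 x] φ
    filter_upwards [Germ.isOpen_iff.1 hU.isOpen φ hφ x hx hg, φ.open_source.mem_nhds hx]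
      with y h1 h2
    exact hp _ (h1 h2)
  · intro H
    refine ⟨{g | ∃ φ hφ x hx, g = mk φ hφ x hx ∧ h =ᶠ[𝓝 x] φ}, ⟨⟨?_, ?_, ?_⟩, ?_, ?_⟩, ?_⟩
    · refine Germ.isOpen_iff.2 ?_
      rintro φ hφ x hx ⟨ψ, hψ, y, hy, he, hh⟩
      replace he := mk_eq_mk.1 he
      obtain ⟨rfl, he⟩ := he
      filter_upwards [(hh.trans he.symm).eventually_nhds] with y h1 h2
      exact ⟨φ, hφ, y, h2, rfl, h1⟩
    · rintro _ ⟨φ, hφ, x, hx, rfl, h1⟩ _ ⟨ψ, hψ, y, hy, rfl, h2⟩ (rfl : x = y)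
      exact mk_eq_mk.2 ⟨rfl, h1.symm.trans h2⟩
    · rintro _ ⟨φ, hφ, x, hx, rfl, h1⟩ _ ⟨ψ, hψ, y, hy, rfl, h2⟩ (he : φ x = ψ y)
      rw [← h1.eq_of_nhds, ← h2.eq_of_nhds] at he
      obtain rfl := h.injective he
      exact mk_eq_mk.2 ⟨rfl, h1.symm.trans h2⟩
    · refine eq_univ_of_forall fun x => ?_
      obtain ⟨φ, hφ, hx, hh⟩ := H x
      exact ⟨_, ⟨φ, hφ, x, hx, rfl, hh⟩, rfl⟩
    · refine eq_univ_of_forall fun y => ?_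
      obtain ⟨x, rfl⟩ := h.surjective y
      obtain ⟨φ, hφ, hx, hh⟩ := H x
      exact ⟨_, ⟨φ, hφ, x, hx, rfl, hh⟩, hh.eq_of_nhds.symm⟩
    · rintro _ ⟨φ, hφ, x, hx, rfl, hh⟩
      exact hh.eq_of_nhds

end Germs

/-! ### Tables -/

section Take

variable {A : Type*}

/-- The word formed by the first `n` letters of `ξ`. -/
def take : (n : ℕ) → (ℕ → A) → List.Vector A n
  | 0, _ => List.Vector.nil
  | n + 1, ξ => ξ 0 ::ᵥ take n (drop 1 ξ)

theorem prepend_take_drop (n : ℕ) (ξ : ℕ → A) : prepend (take n ξ).1 (drop n ξ) = ξ := by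
  induction n generalizing ξ with
  | zero => rfl
  | succ n ih =>
    change cons (ξ 0) (prepend (take n (drop 1 ξ)).1 (drop n (drop 1 ξ))) = ξ
    rw [ih, cons_drop]

theorem mem_cylinder_take (n : ℕ) (ξ : ℕ → A) : ξ ∈ cylinder (take n ξ).1 :=
  ⟨_, prepend_take_drop n ξ⟩

theorem take_eq_of_mem_cylinder {n : ℕ} {w : List.Vector A n} {ξ : ℕ → A}
    (h : ξ ∈ cylinder w.1) : take n ξ = w :=
  Subtype.ext (cylinder_unique ((take n ξ).2.trans w.2.symm) (mem_cylinder_take n ξ) h)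

theorem take_prepend {n : ℕ} (w : List.Vector A n) (ξ : ℕ → A) : take n (prepend w.1 ξ) = w :=
  take_eq_of_mem_cylinder ⟨ξ, rfl⟩

theorem drop_prepend' {n : ℕ} (w : List.Vector A n) (ξ : ℕ → A) : drop n (prepend w.1 ξ) = ξ := by
  have := drop_prepend w.1 ξ
  rwa [w.2] at this

/-- Two prefixes of the same infinite word are comparable. -/
theorem exists_eq_append_of_mem_cylinder {w v : List A} (h : w.length ≤ v.length) {ξ : ℕ → A}
    (hw : ξ ∈ cylinder w) (hv : ξ ∈ cylinder v) : ∃ u, v = w ++ u := by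
  obtain ⟨ζ, rfl⟩ := hw
  have h1 := mem_cylinder_take (v.length - w.length) ζ
  obtain ⟨θ, hθ⟩ := h1
  refine ⟨(take (v.length - w.length) ζ).1, cylinder_unique ?_ hv ⟨θ, ?_⟩⟩
  · rw [List.length_append, (take _ ζ).2]; omega
  · rw [prepend_append, hθ]

/-- The word `w x`. -/
def snoc {n : ℕ} (w : List.Vector A n) (x : A) : List.Vector A (n + 1) :=
  ⟨w.1 ++ [x], by rw [List.length_append, w.2]; rfl⟩

theorem prepend_snoc {n : ℕ} (w : List.Vector A n) (x : A) (ξ : ℕ → A) :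
    prepend (snoc w x).1 ξ = prepend w.1 (cons x ξ) :=
  prepend_append _ _ _

theorem snoc_inj {n : ℕ} {w v : List.Vector A n} {x y : A} :
    snoc w x = snoc v y ↔ w = v ∧ x = y := by
  refine ⟨fun h => ?_, fun h => by rw [h.1, h.2]⟩
  obtain ⟨h1, h2⟩ := List.append_inj' (congrArg Subtype.val h) rfl
  exact ⟨Subtype.ext h1, (List.cons.inj h2).1⟩

end Take

namespace SelfSimilarGroup

variable {Γ : Type*} [Group Γ] {A : Type*} (S : SelfSimilarGroup Γ A)

/-- The element `η` is the iterated restriction of `γ` along `w`; the point is that it does not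
depend on `ξ`. -/
theorem exists_actInf_prepend_eq (γ : Γ) (w : List A) :
    ∃ η, ∀ ξ, S.actInf γ (prepend w ξ) = prepend (S.act γ w) (S.actInf η ξ) := by
  induction w generalizing γ with
  | nil => rw [act_nil]; exact ⟨γ, fun _ => rfl⟩
  | cons x w ih =>
    obtain ⟨η, hη⟩ := ih (S.restrict γ x)
    refine ⟨η, fun ξ => ?_⟩
    rw [act_cons]
    change S.actInf γ (cons x (prepend w ξ)) = cons _ (prepend _ _)
    rw [actInf_cons, hη]

variable {n : ℕ}

/-- The map `w ξ ↦ σ(w) (g_w · ξ)` for words `w` of length `n`. -/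
noncomputable def tableFun (σ : List.Vector A n → List.Vector A n) (g : List.Vector A n → Γ)
    (ξ : ℕ → A) : ℕ → A :=
  prepend (σ (take n ξ)).1 (S.actInf (g (take n ξ)) (drop n ξ))

theorem tableFun_prepend (σ : List.Vector A n → List.Vector A n) (g : List.Vector A n → Γ)
    (w : List.Vector A n) (ξ : ℕ → A) :
    S.tableFun σ g (prepend w.1 ξ) = prepend (σ w).1 (S.actInf (g w) ξ) := by
  rw [tableFun, take_prepend, drop_prepend']

theorem tableFun_comp (σ τ : List.Vector A n → List.Vector A n) (g k : List.Vector A n → Γ)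
    (ξ : ℕ → A) :
    S.tableFun σ g (S.tableFun τ k ξ) = S.tableFun (σ ∘ τ) (fun w => g (τ w) * k w) ξ := by
  rw [← prepend_take_drop n ξ, tableFun_prepend, tableFun_prepend, tableFun_prepend, actInf_mul]
  rfl

theorem tableFun_id (ξ : ℕ → A) : S.tableFun id (fun _ : List.Vector A n => 1) ξ = ξ := by
  rw [← prepend_take_drop n ξ, tableFun_prepend, actInf_one, id]

variable [TopologicalSpace A] [DiscreteTopology A]

theorem tableFun_eventuallyEq (σ : List.Vector A n → List.Vector A n) (g : List.Vector A n → Γ)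
    (ξ : ℕ → A) :
    S.tableFun σ g =ᶠ[𝓝 ξ] S.localMap (σ (take n ξ)).1 (g (take n ξ)) (take n ξ).1 := by
  filter_upwards [(isOpen_cylinder _).mem_nhds (mem_cylinder_take n ξ)] with ζ hζ
  obtain ⟨θ, rfl⟩ := hζ
  rw [tableFun_prepend, localMap_prepend]

theorem continuous_tableFun (σ : List.Vector A n → List.Vector A n) (g : List.Vector A n → Γ) :
    Continuous (S.tableFun σ g) :=
  continuous_iff_continuousAt.2 fun ξ =>
    ((S.localMap _ _ _).continuousAt (mem_cylinder_take n ξ)).congr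
      (S.tableFun_eventuallyEq σ g ξ).symm

/-- The homeomorphism `w ξ ↦ σ(w) (g_w · ξ)` of the space of infinite words. -/
noncomputable def table (σ : Equiv.Perm (List.Vector A n)) (g : List.Vector A n → Γ) :
    (ℕ → A) ≃ₜ (ℕ → A) where
  toFun := S.tableFun σ g
  invFun := S.tableFun σ.symm fun w => (g (σ.symm w))⁻¹
  left_inv ξ := by
    rw [tableFun_comp]
    simp only [Equiv.symm_comp_self, Equiv.symm_apply_apply, inv_mul_cancel, tableFun_id]
  right_inv ξ := by
    rw [tableFun_comp]
    simp only [Equiv.self_comp_symm, mul_inv_cancel, tableFun_id]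
  continuous_toFun := S.continuous_tableFun _ _
  continuous_invFun := S.continuous_tableFun _ _

theorem table_prepend (σ : Equiv.Perm (List.Vector A n)) (g : List.Vector A n → Γ)
    (w : List.Vector A n) (ξ : ℕ → A) :
    S.table σ g (prepend w.1 ξ) = prepend (σ w).1 (S.actInf (g w) ξ) :=
  S.tableFun_prepend _ _ _ _

theorem table_mul (σ τ : Equiv.Perm (List.Vector A n)) (g k : List.Vector A n → Γ) :
    S.table σ g * S.table τ k = S.table (σ * τ) fun w => g (τ w) * k w :=
  Homeomorph.ext fun ξ => S.tableFun_comp _ _ _ _ ξ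

variable [Finite A]

theorem table_mem_fullGroup (σ : Equiv.Perm (List.Vector A n)) (g : List.Vector A n → Γ) :
    S.table σ g ∈ FullGroup S.KernelGroupoid :=
  Germ.mem_fullGroup_iff.2 fun ξ => ⟨_, ⟨_, _, _, by rw [(σ _).2, (take n ξ).2], rfl⟩,
    mem_cylinder_take n ξ, S.tableFun_eventuallyEq σ g ξ⟩

/-- A table as an element of the full group. -/
noncomputable def fullTable (σ : Equiv.Perm (List.Vector A n)) (g : List.Vector A n → Γ) :
    FullGroup S.KernelGroupoid :=
  ⟨S.table σ g, S.table_mem_fullGroup σ g⟩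

theorem fullTable_mul (σ τ : Equiv.Perm (List.Vector A n)) (g k : List.Vector A n → Γ) :
    S.fullTable σ g * S.fullTable τ k = S.fullTable (σ * τ) fun w => g (τ w) * k w :=
  Subtype.ext (S.table_mul σ τ g k)


/-- Every element of the full group is given by a table. -/
theorem exists_eq_fullTable (h : FullGroup S.KernelGroupoid) :
    ∃ (n : ℕ) (σ : Equiv.Perm (List.Vector A n)) (g : List.Vector A n → Γ),
      h = S.fullTable σ g := by
  -- A word is good if `h` acts on its cylinder by a single map `S_(v, g, w)` with `|v| = |w|`.
  -- Goodness passes to longer words, and every infinite word has a good prefix.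
  let good : List A → Prop := fun w => ∃ (v : List A) (g : Γ), v.length = w.length ∧
    ∀ ξ, h.1 (prepend w ξ) = prepend v (S.actInf g ξ)
  have good_append : ∀ w u, good w → good (w ++ u) := by
    rintro w u ⟨v, g, hv, hg⟩
    obtain ⟨η, hη⟩ := S.exists_actInf_prepend_eq g u
    refine ⟨v ++ S.act g u, η, ?_, fun ξ => ?_⟩
    · rw [List.length_append, List.length_append, hv, length_act]
    · rw [prepend_append, prepend_append, hg, hη]
  have good_mono : ∀ m k ξ, m ≤ k → good (take m ξ).1 → good (take k ξ).1 := by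
    intro m k ξ hmk hm
    obtain ⟨u, hu⟩ := exists_eq_append_of_mem_cylinder (w := (take m ξ).1) (v := (take k ξ).1)
      (by rwa [(take m ξ).2, (take k ξ).2]) (mem_cylinder_take m ξ) (mem_cylinder_take k ξ)
    rw [hu]
    exact good_append _ _ hm
  have good_exists : ∀ ξ, ∃ n, good (take n ξ).1 := by
    intro ξ
    obtain ⟨_, ⟨α, g, β, hαβ, rfl⟩, hξ, hh⟩ := Germ.mem_fullGroup_iff.1 h.2 ξ
    obtain ⟨V, hV, hVo, hξV⟩ := eventually_nhds_iff.1 hh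
    obtain ⟨w, hw, hwV⟩ := exists_cylinder_subset hVo hξV
    -- At this length the prefix of `ξ` extends `β`, so the local map restricts to it, and extends
    -- `w`, so its cylinder lies in `V`, where `h` agrees with the local map.
    obtain ⟨k, hk⟩ : ∃ k, k = max w.length β.length := ⟨_, rfl⟩
    refine ⟨k, ?_⟩
    obtain ⟨u, hu⟩ := exists_eq_append_of_mem_cylinder (v := (take k ξ).1)
      (by rw [(take k ξ).2, hk]; exact le_max_right _ _) hξ (mem_cylinder_take k ξ)
    obtain ⟨u', hu'⟩ := exists_eq_append_of_mem_cylinder (v := (take k ξ).1)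
      (by rw [(take k ξ).2, hk]; exact le_max_left _ _) hw (mem_cylinder_take k ξ)
    obtain ⟨η, hη⟩ := S.exists_actInf_prepend_eq g u
    refine ⟨α ++ S.act g u, η, ?_, fun ζ => ?_⟩
    · rw [hu, List.length_append, List.length_append, hαβ, length_act]
    · have hm : prepend (take k ξ).1 ζ ∈ V := by
        apply hwV
        rw [hu', prepend_append]
        exact ⟨_, rfl⟩
      rw [hV _ hm, hu, prepend_append, localMap_prepend, hη, prepend_append]
  have hopen : ∀ n, IsOpen {ξ : ℕ → A | good (take n ξ).1} := by
    intro n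
    rw [isOpen_iff_mem_nhds]
    intro ξ hξ
    filter_upwards [(isOpen_cylinder _).mem_nhds (mem_cylinder_take n ξ)] with ζ hζ
    rw [take_eq_of_mem_cylinder hζ]
    exact hξ
  -- The sets of words with a good prefix of length `n` are open, increase with `n` and cover, so
  -- compactness gives one length that works everywhere.
  obtain ⟨n, hn⟩ := isCompact_univ.elim_directed_cover _ hopen
    (fun ξ _ => mem_iUnion.2 (good_exists ξ))
    (directed_of_isDirected_le fun m k hmk ξ hξ => good_mono m k ξ hmk hξ)
  -- Over an empty alphabet there are no infinite words and any table will do. Otherwise a letter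
  -- `x₀` provides a point in each cylinder.
  by_cases hA : IsEmpty A
  · have : IsEmpty (ℕ → A) := ⟨fun ξ => hA.elim (ξ 0)⟩
    exact ⟨0, 1, 1, Subtype.ext (Homeomorph.ext fun ξ => isEmptyElim ξ)⟩
  rw [not_isEmpty_iff] at hA
  obtain ⟨x₀⟩ := hA
  have hgood : ∀ w : List.Vector A n, ∃ (v : List.Vector A n) (g : Γ),
      ∀ ξ, h.1 (prepend w.1 ξ) = prepend v.1 (S.actInf g ξ) := by
    intro w
    have := hn (mem_univ (prepend w.1 fun _ => x₀))
    rw [mem_ofPred_eq, take_prepend] at this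
    obtain ⟨v, g, hv, hg⟩ := this
    exact ⟨⟨v, hv.trans w.2⟩, g, hg⟩
  choose σ g hσ using hgood
  -- Since `h` is onto, its image meets the cylinder of every `v`. There are finitely many words of
  -- length `n`, so `σ` is then a permutation.
  have hsurj : Function.Surjective σ := by
    intro v
    obtain ⟨ξ, hξ⟩ := h.1.surjective (prepend v.1 fun _ => x₀)
    rw [← prepend_take_drop n ξ, hσ] at hξ
    exact ⟨_, Subtype.ext (prepend_inj (by rw [(σ _).2, v.2]) hξ).1⟩
  refine ⟨n, Equiv.ofBijective σ ⟨Finite.injective_iff_surjective.2 hsurj, hsurj⟩, g,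
    Subtype.ext (Homeomorph.ext fun ξ => ?_)⟩
  rw [← prepend_take_drop n ξ, hσ]
  exact (S.tableFun_prepend σ g _ _).symm

end SelfSimilarGroup


/-! ### Integer-valued functions as combinations of indicators -/

/-- A laminar basis of compact open sets spans the compactly supported integer-valued functions. -/
theorem mem_closure_indicatorCc {X : Type*} [TopologicalSpace X] [T2Space X] {ℬ : Set (Set X)}
    (ho : ∀ B ∈ ℬ, IsOpen B) (hc : ∀ B ∈ ℬ, IsCompact B)
    (hb : ∀ x O, IsOpen O → x ∈ O → ∃ B ∈ ℬ, x ∈ B ∧ B ⊆ O)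
    (hl : ∀ B ∈ ℬ, ∀ C ∈ ℬ, B ⊆ C ∨ C ⊆ B ∨ Disjoint B C) (f : C_c(X, ℤ)) :
    f ∈ AddSubgroup.closure (range fun B : ℬ => indicatorCc B.1 (ho _ B.2) (hc _ B.2)) := by
  classical
  have hB : ∀ x : X, ∃ B : ℬ, x ∈ B.1 ∧ B.1 ⊆ f ⁻¹' {f x} := fun x => by
    obtain ⟨B, hB, h⟩ := hb x _ ((isOpen_discrete {f x}).preimage f.continuous) rfl
    exact ⟨⟨B, hB⟩, h⟩
  choose b hxb hbf using hB
  obtain ⟨s, -, hs⟩ := (show IsCompact (tsupport f) from f.hasCompactSupport).elim_nhds_subcover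
    (fun x => (b x).1) fun x _ => (ho _ (b x).2).mem_nhds (hxb x)
  -- The value of `f` on each set of the finite subcover; off the subcover the value `0` is a dummy.
  have hconst : ∀ B : ℬ, ∃ c : ℤ, B ∈ s.image b → ∀ y ∈ B.1, f y = c := by
    intro B
    by_cases h : B ∈ s.image b
    · obtain ⟨x, -, rfl⟩ := Finset.mem_image.1 h
      exact ⟨f x, fun _ y hy => hbf x hy⟩
    · exact ⟨0, fun h' => absurd h' h⟩
  choose c hcf using hconst
  -- In a laminar family the maximal sets of the subcover are pairwise disjoint and still cover the
  -- support, so `f` is the sum of their indicators weighted by its values on them.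
  let M : Finset ℬ := (s.image b).filter fun B => Maximal (· ∈ s.image b) B
  have hf : f = ∑ B ∈ M, c B • indicatorCc B.1 (ho _ B.2) (hc _ B.2) := by
    ext y
    have heval : (∑ B ∈ M, c B • indicatorCc B.1 (ho _ B.2) (hc _ B.2)) y =
        ∑ B ∈ M, c B * B.1.indicator (fun _ => (1 : ℤ)) y := by
      rw [CompactlySupportedContinuousMap.sum_apply]
      exact Finset.sum_congr rfl fun B _ => smul_eq_mul _ _
    rw [heval]
    by_cases hy : ∃ x ∈ s, y ∈ (b x).1
    · obtain ⟨x, hx, hyx⟩ := hy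
      obtain ⟨B, hBle, hBmax⟩ := (s.image b).exists_le_maximal (Finset.mem_image_of_mem b hx)
      have hyB : y ∈ B.1 := hBle hyx
      have hBM : B ∈ M := Finset.mem_filter.2 ⟨hBmax.prop, hBmax⟩
      rw [Finset.sum_eq_single_of_mem B hBM, indicator_of_mem hyB, mul_one]
      · exact hcf B hBmax.prop y hyB
      · intro C hC hne
        have hCmax := (Finset.mem_filter.1 hC).2
        rw [indicator_of_notMem, mul_zero]
        intro hyC
        rcases hl _ B.2 _ C.2 with h | h | h
        · exact hne (hBmax.eq_of_le hCmax.prop h).symm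
        · exact hne (hCmax.eq_of_le hBmax.prop h)
        · exact disjoint_left.1 h hyB hyC
    · have h0 : f y = 0 := by
        by_contra hne
        obtain ⟨x, hx, hyx⟩ := mem_iUnion₂.1 (hs (subset_tsupport _ hne))
        exact hy ⟨x, hx, hyx⟩
      rw [h0, Finset.sum_eq_zero]
      intro B hBM
      obtain ⟨x, hx, rfl⟩ := Finset.mem_image.1 (Finset.mem_filter.1 hBM).1
      rw [indicator_of_notMem (fun h => hy ⟨x, hx, h⟩), mul_zero]
  rw [hf]
  exact sum_mem fun B _ => zsmul_mem (AddSubgroup.subset_closure (mem_range_self B)) _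

/-! ### Basic bisections of the kernel groupoid and the functionals on its chains. -/

namespace SelfSimilarGroup

open TopGroupoid

variable {Γ : Type*} [Group Γ] {A : Type*} (S : SelfSimilarGroup Γ A)

/-- Triples `(α, g, β)` with `|α| = |β| = n`. -/
abbrev Triple (Γ : Type*) (A : Type*) (n : ℕ) : Type _ := List.Vector A n × Γ × List.Vector A n

/-- The triple `(α (g · x), g|ₓ, β x)`. -/
noncomputable def Triple.extend {n : ℕ} (t : Triple Γ A n) (x : A) : Triple Γ A (n + 1) :=
  (snoc t.1 (S.letter t.2.1 x), S.restrict t.2.1 x, snoc t.2.2 x)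

variable [TopologicalSpace A] [DiscreteTopology A] {n : ℕ}

theorem localMap_mem (t : Triple Γ A n) :
    S.localMap t.1.1 t.2.1 t.2.2.1 ∈ S.kernelSystem.carrier :=
  ⟨_, _, _, by rw [t.1.2, t.2.2.2], rfl⟩

/-- The germ `[α, g, β; β ξ]`. -/
noncomputable def arrow (t : Triple Γ A n) (ξ : ℕ → A) : S.KernelGroupoid :=
  Germ.mk _ (S.localMap_mem t) (prepend t.2.2.1 ξ) ⟨ξ, rfl⟩

theorem s_arrow (t : Triple Γ A n) (ξ : ℕ → A) : s (S.arrow t ξ) = prepend t.2.2.1 ξ := rfl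

theorem r_arrow (t : Triple Γ A n) (ξ : ℕ → A) :
    r (S.arrow t ξ) = prepend t.1.1 (S.actInf t.2.1 ξ) :=
  S.localMap_prepend _ _ _ _

theorem continuous_arrow (t : Triple Γ A n) : Continuous (S.arrow t) := by
  refine ⟨fun T hT => ?_⟩
  rw [isOpen_iff_mem_nhds]
  intro ξ hξ
  filter_upwards [(continuous_prepend t.2.2.1).continuousAt.eventually
    (Germ.isOpen_iff.1 hT _ (S.localMap_mem t) _ ⟨ξ, rfl⟩ hξ)] with ζ hζ using hζ _

/-- This is the rule `g · (x ξ) = (g · x) (g|ₓ · ξ)` read on germs: the same germ is written one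
level deeper. -/
theorem arrow_extend (t : Triple Γ A n) (x : A) (ξ : ℕ → A) :
    S.arrow (t.extend S x) ξ = S.arrow t (cons x ξ) := by
  refine Germ.mk_eq_mk.2 ⟨prepend_append _ _ _, ?_⟩
  filter_upwards [(isOpen_cylinder _).mem_nhds ⟨ξ, rfl⟩]
  rintro _ ⟨θ, rfl⟩
  rw [localMap_prepend]
  change prepend (t.1.1 ++ [S.letter t.2.1 x]) (S.actInf (S.restrict t.2.1 x) θ) =
    S.localMap t.1.1 t.2.1 t.2.2.1 (prepend (t.2.2.1 ++ [x]) θ)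
  rw [prepend_append, prepend_append, localMap_prepend]
  change prepend _ (cons _ _) = prepend _ (S.actInf t.2.1 (cons x θ))
  rw [actInf_cons]; rfl

theorem mul_arrow (α β γ : List.Vector A n) (g h : Γ) (ξ : ℕ → A)
    (H : s (S.arrow (α, g, β) (S.actInf h ξ)) = r (S.arrow (β, h, γ) ξ)) :
    mul (S.arrow (α, g, β) (S.actInf h ξ)) (S.arrow (β, h, γ) ξ) H =
      S.arrow (α, g * h, γ) ξ := by
  refine Germ.product_mk H (S.localMap_mem (α, g * h, γ)) ⟨ξ, rfl⟩ ?_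
  filter_upwards [(isOpen_cylinder _).mem_nhds ⟨ξ, rfl⟩]
  rintro _ ⟨θ, rfl⟩
  change S.localMap α.1 (g * h) γ.1 (prepend γ.1 θ) =
    S.localMap α.1 g β.1 (S.localMap β.1 h γ.1 (prepend γ.1 θ))
  rw [localMap_prepend, localMap_prepend, localMap_prepend, actInf_mul]

/-- At a fixed level the source and range determine the two words. If `g` and `k` then give the same
germ, `k⁻¹ g` fixes a cylinder pointwise and is trivial by pseudo-freeness. Hence the group element
at a given level is well defined, which is what lets `levelSum` read it off. -/
theorem arrow_injective [Nonempty A] (hS : S.IsPseudoFree) {t u : Triple Γ A n} {ξ ζ : ℕ → A}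
    (h : S.arrow t ξ = S.arrow u ζ) : t = u := by
  replace h := Germ.mk_eq_mk.1 h
  obtain ⟨α, g, β⟩ := t
  obtain ⟨γ, k, δ⟩ := u
  obtain ⟨h1, h2⟩ := h
  change prepend β.1 ξ = prepend δ.1 ζ at h1
  change S.localMap α.1 g β.1 =ᶠ[𝓝 (prepend β.1 ξ)] S.localMap γ.1 k δ.1 at h2
  obtain ⟨h3, rfl⟩ := prepend_inj (by rw [β.2, δ.2]) h1
  obtain rfl := Subtype.ext h3
  have h4 := h2.eq_of_nhds
  rw [localMap_prepend, localMap_prepend] at h4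
  obtain rfl := Subtype.ext (prepend_inj (by rw [α.2, γ.2]) h4).1
  obtain ⟨V, hV, hVo, hξ⟩ :=
    eventually_nhds_iff.1 ((continuous_prepend β.1).continuousAt.eventually h2)
  obtain ⟨w, -, hw⟩ := exists_cylinder_subset hVo hξ
  have h5 : k⁻¹ * g = 1 := by
    refine S.eq_one_of_fix hS w fun η hη => ?_
    have h6 := hV η (hw hη)
    rw [localMap_prepend, localMap_prepend] at h6
    rw [actInf_mul, (prepend_inj rfl h6).2, actInf_inv_actInf]
  obtain rfl : k = g := inv_mul_eq_one.1 h5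
  rfl

/-- The compact open bisection `{[α, g, β; ξ] : ξ ∈ Z(β)}`. -/
noncomputable def basic (t : Triple Γ A n) : Set S.KernelGroupoid := range (S.arrow t)

theorem isBisection_basic (t : Triple Γ A n) : IsBisection (S.basic t) where
  isOpen := by
    have : S.basic t = Germ.basicSet _ (S.localMap_mem t) univ := by
      ext g
      constructor
      · rintro ⟨ξ, rfl⟩
        exact ⟨_, ⟨ξ, rfl⟩, trivial, rfl⟩
      · rintro ⟨_, ⟨ξ, rfl⟩, -, rfl⟩
        exact ⟨ξ, rfl⟩
    rw [this]
    exact Germ.isOpen_basicSet _ _ isOpen_univ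
  injOn_s := by
    rintro _ ⟨ξ, rfl⟩ _ ⟨ζ, rfl⟩ he
    rw [s_arrow, s_arrow] at he
    rw [(prepend_inj rfl he).2]
  injOn_r := by
    rintro _ ⟨ξ, rfl⟩ _ ⟨ζ, rfl⟩ he
    rw [r_arrow, r_arrow] at he
    rw [← S.actInf_inv_actInf t.2.1 ξ, (prepend_inj rfl he).2, actInf_inv_actInf]

theorem image_s_basic (t : Triple Γ A n) : s '' S.basic t = cylinder t.2.2.1 := by
  rw [basic, ← range_comp]; rfl

theorem image_r_basic (t : Triple Γ A n) : r '' S.basic t = cylinder t.1.1 := by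
  ext ξ
  constructor
  · rintro ⟨_, ⟨ζ, rfl⟩, rfl⟩
    exact ⟨_, (S.r_arrow t ζ).symm⟩
  -- The action of `g` on infinite words is onto, so every point of the cylinder is the range of
  -- some germ.
  · rintro ⟨ζ, rfl⟩
    exact ⟨_, ⟨S.actInf t.2.1⁻¹ ζ, rfl⟩, by rw [r_arrow, actInf_actInf_inv]⟩

theorem isCompact_basic [Finite A] (t : Triple Γ A n) : IsCompact (S.basic t) :=
  isCompact_range (S.continuous_arrow t)

theorem setMul_basic (α β γ : List.Vector A n) (g h : Γ) :
    setMul (S.basic (α, g, β)) (S.basic (β, h, γ)) = S.basic (α, g * h, γ) := by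
  ext k
  constructor
  · rintro ⟨_, ⟨ζ, rfl⟩, _, ⟨ξ, rfl⟩, H, rfl⟩
    have e : ζ = S.actInf h ξ := by
      have H' := H
      rw [s_arrow, r_arrow] at H'
      exact (prepend_inj rfl H').2
    subst e
    exact ⟨ξ, (S.mul_arrow α β γ g h ξ H).symm⟩
  · rintro ⟨ξ, rfl⟩
    have H : s (S.arrow (α, g, β) (S.actInf h ξ)) = r (S.arrow (β, h, γ) ξ) := by
      rw [s_arrow, r_arrow]
    exact ⟨_, ⟨_, rfl⟩, _, ⟨ξ, rfl⟩, H, S.mul_arrow α β γ g h ξ H⟩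

theorem mem_basic_iff_extend (t : Triple Γ A n) (k : S.KernelGroupoid) :
    k ∈ S.basic t ↔ ∃ x, k ∈ S.basic (t.extend S x) := by
  constructor
  · rintro ⟨ξ, rfl⟩
    exact ⟨ξ 0, drop 1 ξ, by rw [arrow_extend, cons_drop]⟩
  · rintro ⟨x, ξ, rfl⟩
    exact ⟨_, (S.arrow_extend t x ξ).symm⟩

theorem exists_basic_subset {m : ℕ} (hmn : m ≤ n) {t : Triple Γ A m} {k : S.KernelGroupoid}
    (hk : k ∈ S.basic t) : ∃ u : Triple Γ A n, k ∈ S.basic u ∧ S.basic u ⊆ S.basic t := by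
  induction n, hmn using Nat.le_induction with
  | base => exact ⟨t, hk, subset_rfl⟩
  | succ n _ ih =>
    obtain ⟨u, hu, hs⟩ := ih
    obtain ⟨x, hx⟩ := (S.mem_basic_iff_extend u k).1 hu
    exact ⟨_, hx, fun l hl => hs ((S.mem_basic_iff_extend u l).2 ⟨x, hl⟩)⟩

/-- Refining `t` around `k` to level `n` must give `u`, by `arrow_injective`. So two basic
bisections that meet are nested. -/
theorem basic_subset_basic [Nonempty A] (hS : S.IsPseudoFree) {m : ℕ} (hmn : m ≤ n)
    {t : Triple Γ A m} {u : Triple Γ A n} {k : S.KernelGroupoid} (ht : k ∈ S.basic t)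
    (hu : k ∈ S.basic u) : S.basic u ⊆ S.basic t := by
  obtain ⟨v, ⟨ξ, rfl⟩, hs⟩ := S.exists_basic_subset hmn ht
  obtain ⟨ζ, hζ⟩ := hu
  rwa [S.arrow_injective hS hζ]

theorem exists_basic_mem_subset {O : Set S.KernelGroupoid} (hO : IsOpen O) {k : S.KernelGroupoid}
    (hk : k ∈ O) : ∃ (n : ℕ) (t : Triple Γ A n), k ∈ S.basic t ∧ S.basic t ⊆ O := by
  obtain ⟨φ, hφ, x, hx, rfl⟩ := Germ.exists_rep k
  obtain ⟨α, g, β, hαβ, rfl⟩ := id hφ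
  obtain ⟨ξ, rfl⟩ := id hx
  let t : Triple Γ A β.length := (⟨α, hαβ⟩, g, ⟨β, rfl⟩)
  obtain ⟨V, hV, hVo, hxV⟩ := eventually_nhds_iff.1 (Germ.isOpen_iff.1 hO _ hφ _ hx hk)
  obtain ⟨w, hw, hwV⟩ := exists_cylinder_subset hVo hxV
  -- A refinement deep enough for the source cylinder of `u` to lie inside that of `w`, hence inside
  -- `V`.
  obtain ⟨u, hu, hs⟩ := S.exists_basic_subset (t := t) (le_max_left β.length w.length) ⟨ξ, rfl⟩
  refine ⟨_, u, hu, fun l hl => ?_⟩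
  obtain ⟨ζ, rfl⟩ := hs hl
  refine hV _ (hwV ?_) ⟨ζ, rfl⟩
  have hl' := mem_image_of_mem s hl
  have hu' := mem_image_of_mem s hu
  rw [image_s_basic] at hl' hu'
  obtain ⟨v, hv⟩ := exists_eq_append_of_mem_cylinder (v := u.2.2.1)
    (by rw [u.2.2.2]; exact le_max_right _ _) hw hu'
  rw [hv] at hl'
  obtain ⟨θ, hθ⟩ := hl'
  exact ⟨prepend v θ, by rw [← prepend_append, hθ]; rfl⟩

/-- The basic compact open sets of composable pairs. -/
def basicPairs : Set (Set (Composable S.KernelGroupoid)) :=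
  {B | ∃ (n : ℕ) (α β γ : List.Vector A n) (g h : Γ),
    B = setPair (S.basic (α, g, β)) (S.basic (β, h, γ))}

theorem exists_basicPairs_subset {O : Set (Composable S.KernelGroupoid)} (hO : IsOpen O)
    {p : Composable S.KernelGroupoid} (hp : p ∈ O) : ∃ B ∈ S.basicPairs, p ∈ B ∧ B ⊆ O := by
  obtain ⟨O', hO', rfl⟩ := isOpen_induced_iff.1 hO
  obtain ⟨U, V, hU, hV, hpU, hpV, hUV⟩ := isOpen_prod_iff.1 hO' p.1.1 p.1.2 hp
  obtain ⟨n, t, ht, htU⟩ := S.exists_basic_mem_subset hU hpU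
  obtain ⟨m, u, hu, huV⟩ := S.exists_basic_mem_subset hV hpV
  -- Both factors are brought to a common level. The inner words `β` and `β'` are then equal-length
  -- prefixes of the same point, the source of the first arrow and the range of the second, so they
  -- coincide.
  obtain ⟨⟨α, g, β⟩, ht', hst⟩ := S.exists_basic_subset (le_max_left n m) ht
  obtain ⟨⟨β', h, γ⟩, hu', hsu⟩ := S.exists_basic_subset (le_max_right n m) hu
  have e : β = β' := by
    have h1 := mem_image_of_mem s ht'
    have h2 := mem_image_of_mem r hu'
    rw [image_s_basic, p.2] at h1
    rw [image_r_basic] at h2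
    exact Subtype.ext (cylinder_unique (by rw [β.2, β'.2]) h1 h2)
  subst e
  exact ⟨_, ⟨_, α, β, γ, g, h, rfl⟩, ⟨ht', hu'⟩,
    fun q hq => hUV ⟨htU (hst hq.1), huV (hsu hq.2)⟩⟩

/-- When two pair sets meet, the one of deeper level is contained in the other factor by factor.
This supplies the laminarity needed by `mem_closure_indicatorCc`. -/
theorem basicPairs_laminar [Nonempty A] (hS : S.IsPseudoFree)
    {B C : Set (Composable S.KernelGroupoid)} (hB : B ∈ S.basicPairs)
    (hC : C ∈ S.basicPairs) : B ⊆ C ∨ C ⊆ B ∨ Disjoint B C := by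
  by_cases hd : Disjoint B C
  · exact Or.inr (Or.inr hd)
  obtain ⟨p, hpB, hpC⟩ := not_disjoint_iff.1 hd
  obtain ⟨n, α, β, γ, g, h, rfl⟩ := hB
  obtain ⟨m, α', β', γ', g', h', rfl⟩ := hC
  rcases le_total n m with hnm | hnm
  · exact Or.inr (Or.inl fun q hq => ⟨S.basic_subset_basic hS hnm hpB.1 hpC.1 hq.1,
      S.basic_subset_basic hS hnm hpB.2 hpC.2 hq.2⟩)
  · exact Or.inl fun q hq => ⟨S.basic_subset_basic hS hnm hpC.1 hpB.1 hq.1,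
      S.basic_subset_basic hS hnm hpC.2 hpB.2 hq.2⟩

variable [Fintype A] [T2Space S.KernelGroupoid]

/-- The indicator of `{[α, g, β; ξ] : ξ ∈ Z(β)}`. -/
noncomputable def basicChain (t : Triple Γ A n) : C_c(S.KernelGroupoid, ℤ) :=
  indicatorCc (S.basic t) (S.isBisection_basic t).isOpen (S.isCompact_basic t)

/-- A basic bisection is the disjoint union of its one-letter extensions. This relation is why a
functional `basicChain t ↦ ψ(g)` needs `ψ(g) = ∑ₓ ψ(g|ₓ)`. -/
theorem basicChain_eq_sum (t : Triple Γ A n) :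
    S.basicChain t = ∑ x, S.basicChain (t.extend S x) := by
  classical
  ext k
  rw [CompactlySupportedContinuousMap.sum_apply]
  change (S.basic t).indicator (fun _ => (1 : ℤ)) k =
    ∑ x, (S.basic (t.extend S x)).indicator (fun _ => (1 : ℤ)) k
  by_cases hk : k ∈ S.basic t
  · obtain ⟨x, ξ, hx⟩ := (S.mem_basic_iff_extend t k).1 hk
    rw [Finset.sum_eq_single x, indicator_of_mem hk,
      indicator_of_mem (show k ∈ S.basic (t.extend S x) from ⟨ξ, hx⟩)]
    · intro y _ hyx
      rw [indicator_of_notMem]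
      rintro ⟨ζ, hy⟩
      apply hyx
      -- The next letter of the source tells the extensions apart.
      rw [← hy, arrow_extend, arrow_extend] at hx
      have := congrArg s hx
      rw [s_arrow, s_arrow] at this
      exact (cons_inj (prepend_inj rfl this).2).1.symm
    · exact fun h => absurd (Finset.mem_univ x) h
  · rw [indicator_of_notMem hk, Finset.sum_eq_zero]
    exact fun x _ => indicator_of_notMem (fun h => hk ((S.mem_basic_iff_extend t k).2 ⟨x, h⟩)) _

/-- There may be infinitely many triples because `Γ` may be infinite. Finiteness comes from compact
support: there are finitely many `β`, over each source finitely many germs in the support, and each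
germ belongs to at most one triple of level `n`. -/
theorem finite_arrow_support [Nonempty A] (hS : S.IsPseudoFree) (f : C_c(S.KernelGroupoid, ℤ))
    (ξ : ℕ → A) : {t : Triple Γ A n | f (S.arrow t ξ) ≠ 0}.Finite := by
  have h1 : (⋃ β : List.Vector A n, s ⁻¹' {prepend β.1 ξ} ∩ Function.support f).Finite :=
    finite_iUnion fun β => fiber_support_finite IsAmple.isLocalHomeomorph_s f _
  exact (h1.preimage fun t _ u _ h => S.arrow_injective hS h).subset fun t ht =>
    mem_iUnion.2 ⟨t.2.2, rfl, ht⟩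

/-! ### Functionals that vanish on boundaries. -/

section Functional

variable {M : Type*} [AddCommGroup M]

/-- The functional `f ↦ ∑ f([α, g, β; β ξ]) ψ(g)`, summed over `|α| = |β| = n`. -/
noncomputable def levelSum [Nonempty A] (hS : S.IsPseudoFree) (ψ : Γ → M) (ξ : ℕ → A) (n : ℕ) :
    C_c(S.KernelGroupoid, ℤ) →+ M where
  toFun f := ∑ᶠ t : Triple Γ A n, f (S.arrow t ξ) • ψ t.2.1
  map_zero' := by simp
  map_add' f f' := by
    rw [← finsum_add_distrib]
    · exact finsum_congr fun t => add_smul _ _ _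
    · exact (S.finite_arrow_support hS f ξ).subset fun t ht h => ht (by simp only [h, zero_smul])
    · exact (S.finite_arrow_support hS f' ξ).subset fun t ht h => ht (by simp only [h, zero_smul])

variable [Nonempty A] (hS : S.IsPseudoFree) (ψ : Γ → M) (ξ : ℕ → A)

theorem levelSum_basicChain_self (t : Triple Γ A n) :
    S.levelSum hS ψ ξ n (S.basicChain t) = ψ t.2.1 := by
  change (∑ᶠ u : Triple Γ A n, (S.basic t).indicator (fun _ => (1 : ℤ)) (S.arrow u ξ) • ψ u.2.1) = _
  rw [finsum_eq_single _ t, indicator_of_mem (show S.arrow t ξ ∈ S.basic t from ⟨ξ, rfl⟩), one_smul]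
  intro u hu
  rw [indicator_of_notMem, zero_smul]
  rintro ⟨ζ, hζ⟩
  exact hu (S.arrow_injective hS hζ).symm

/-- Subdividing the bisection down to level `n` leaves the total value unchanged, by the hypothesis
on `ψ`; at level `n` exactly one triple contributes. -/
theorem levelSum_basicChain {ψ : Γ → M} (hψ : ∀ g, ψ g = ∑ x, ψ (S.restrict g x))
    {m : ℕ} (hmn : m ≤ n) (t : Triple Γ A m) :
    S.levelSum hS ψ ξ n (S.basicChain t) = ψ t.2.1 := by
  obtain ⟨k, rfl⟩ := Nat.exists_eq_add_of_le hmn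
  clear hmn
  -- The target level gets a name so that it stays fixed while the induction trades a unit of `k`
  -- for a unit of `m`.
  obtain ⟨n, hn⟩ : ∃ n, n = m + k := ⟨_, rfl⟩
  rw [← hn]
  induction k generalizing m with
  | zero => subst hn; exact S.levelSum_basicChain_self hS ψ ξ t
  | succ k ih =>
    rw [basicChain_eq_sum, map_sum, hψ]
    exact Finset.sum_congr rfl fun x _ => ih (t.extend S x) (by omega)

/-- A 2-chain is an integer combination of indicators of basic pairs, and on a pair with group
elements `g` and `h` the boundary has value `ψ(h) - ψ(gh) + ψ(g) = 0`. The evaluation is valid from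
the level of the pair onwards, hence the quantifier `∀ᶠ`. -/
theorem eventually_levelSum_delta₂ {ψ : Γ → M} (hψ : ∀ g, ψ g = ∑ x, ψ (S.restrict g x))
    (hmul : ∀ g h, ψ (g * h) = ψ g + ψ h)
    (F : C_c(Composable S.KernelGroupoid, ℤ)) :
    ∀ᶠ n in atTop, S.levelSum hS ψ ξ n (delta₂ S.KernelGroupoid F) = 0 := by
  have ho : ∀ B ∈ S.basicPairs, IsOpen B := by
    rintro _ ⟨n, α, β, γ, g, h, rfl⟩
    exact isOpen_setPair (S.isBisection_basic _).isOpen (S.isBisection_basic _).isOpen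
  have hc : ∀ B ∈ S.basicPairs, IsCompact B := by
    rintro _ ⟨n, α, β, γ, g, h, rfl⟩
    exact isCompact_setPair (S.isCompact_basic _) (S.isCompact_basic _)
  have hF := mem_closure_indicatorCc ho hc
    (fun _ _ hO hx => S.exists_basicPairs_subset hO hx)
    (fun _ hB _ hC => S.basicPairs_laminar hS hB hC) F
  induction hF using AddSubgroup.closure_induction with
  | mem F hF =>
    obtain ⟨⟨_, m, α, β, γ, g, h, rfl⟩, rfl⟩ := hF
    have e : delta₂ S.KernelGroupoid (indicatorCc _ (ho _ ⟨m, α, β, γ, g, h, rfl⟩)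
        (hc _ ⟨m, α, β, γ, g, h, rfl⟩)) =
        S.basicChain (β, h, γ) - S.basicChain (α, g * h, γ) + S.basicChain (α, g, β) := by
      ext k
      rw [delta₂_indicator_setPair (S.isBisection_basic _) (S.isBisection_basic _)
        (by rw [image_s_basic, image_r_basic]), setMul_basic]
      rfl
    filter_upwards [eventually_ge_atTop m] with n hn
    rw [e, map_add, map_sub, S.levelSum_basicChain hS ξ hψ hn, S.levelSum_basicChain hS ξ hψ hn,
      S.levelSum_basicChain hS ξ hψ hn, hmul]
    abel
  | zero => exact Eventually.of_forall fun n => by rw [map_zero, map_zero]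
  | add F F' _ _ hF hF' =>
    filter_upwards [hF, hF'] with n h h'
    rw [map_add, map_add, h, h', add_zero]
  | neg F _ hF =>
    filter_upwards [hF] with n h
    rw [map_neg, map_neg, h, neg_zero]

end Functional

/-- A homomorphism `ψ` to an abelian group with `ψ(g) = ∑ₓ ψ(g|ₓ)` vanishes on `g` if the
bisection of `(α, g, β)` is full and has trivial class in `H₁`. -/
theorem eq_zero_of_homClass_eq_zero [Nonempty A] (hS : S.IsPseudoFree) {M : Type*} [AddCommGroup M]
    {ψ : Γ → M}
    (hψ : ∀ g, ψ g = ∑ x, ψ (S.restrict g x)) (hmul : ∀ g h, ψ (g * h) = ψ g + ψ h)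
    (t : Triple Γ A n) (hf : IsFullBisection (S.basic t)) (h0 : hf.homClass = 0) :
    ψ t.2.1 = 0 := by
  rw [IsFullBisection.homClass, QuotientAddGroup.eq_zero_iff, AddSubgroup.mem_addSubgroupOf] at h0
  obtain ⟨F, hF⟩ := h0
  obtain ⟨x⟩ := ‹Nonempty A›
  -- A level deep enough both for the boundary to evaluate to zero and for the bisection of `t` to
  -- evaluate to `ψ(g)`. The base point plays no role, so a constant word is used.
  obtain ⟨m, hm, hn⟩ := ((S.eventually_levelSum_delta₂ hS (fun _ => x) hψ hmul F).and
    (eventually_ge_atTop n)).exists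
  rw [hF] at hm
  rw [← S.levelSum_basicChain hS (fun _ => x) hψ hn t]
  exact hm


end SelfSimilarGroup


/-! ### Tables modulo transpositions. -/

namespace SelfSimilarGroup

variable {Γ : Type*} [Group Γ] {A : Type*} (S : SelfSimilarGroup Γ A) [TopologicalSpace A]
  [DiscreteTopology A] [Finite A] {n : ℕ}

theorem fullTable_prepend (σ : Equiv.Perm (List.Vector A n)) (g : List.Vector A n → Γ)
    (w : List.Vector A n) (ξ : ℕ → A) :
    (S.fullTable σ g).1 (prepend w.1 ξ) = prepend (σ w).1 (S.actInf (g w) ξ) :=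
  S.table_prepend _ _ _ _

/-- The extra letter `x` allows a table over words of length `n` to be compared with one over words
of length `n + 1`. -/
theorem fullGroup_ext {h k : FullGroup S.KernelGroupoid} (n : ℕ)
    (H : ∀ (w : List.Vector A n) (x : A) (ξ : ℕ → A),
      h.1 (prepend w.1 (cons x ξ)) = k.1 (prepend w.1 (cons x ξ))) : h = k := by
  refine Subtype.ext (Homeomorph.ext fun ξ => ?_)
  have := H (take n ξ) (drop n ξ 0) (drop 1 (drop n ξ))
  rwa [cons_drop, prepend_take_drop] at this

/-- The homomorphism that maps a permutation `σ` of words to `w ξ ↦ σ(w) ξ`. -/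
noncomputable def permHom (n : ℕ) : Equiv.Perm (List.Vector A n) →* FullGroup S.KernelGroupoid :=
  MonoidHom.mk' (fun σ => S.fullTable σ 1) fun σ τ => by
    rw [fullTable_mul]
    congr 1
    exact (mul_one 1).symm

/-- The homomorphism that maps a family `g` to `w ξ ↦ w (g_w · ξ)`. -/
noncomputable def diagHom (n : ℕ) : (List.Vector A n → Γ) →* FullGroup S.KernelGroupoid :=
  MonoidHom.mk' (fun g => S.fullTable 1 g) fun g k => by
    rw [fullTable_mul]
    rfl

theorem fullTable_eq_mul (σ : Equiv.Perm (List.Vector A n)) (g : List.Vector A n → Γ) :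
    S.fullTable σ g = S.permHom n σ * S.diagHom n g := by
  change _ = S.fullTable σ 1 * S.fullTable 1 g
  rw [fullTable_mul, mul_one]
  congr 1
  exact (one_mul g).symm

section Swap

variable [DecidableEq A]

theorem isTransposition_fullTable_swap {w v : List.Vector A n} (hwv : w ≠ v)
    {k : List.Vector A n → Γ} (h : k v * k w = 1) (h1 : ∀ u, u ≠ w → u ≠ v → k u = 1) :
    IsTransposition (S.fullTable (Equiv.swap w v) k) := by
  have hw : ∀ ξ, (S.fullTable (Equiv.swap w v) k).1 (prepend w.1 ξ) =
      prepend v.1 (S.actInf (k w) ξ) := fun ξ => by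
    rw [fullTable_prepend, Equiv.swap_apply_left]
  have hv : ∀ ξ, (S.fullTable (Equiv.swap w v) k).1 (prepend v.1 ξ) =
      prepend w.1 (S.actInf (k v) ξ) := fun ξ => by
    rw [fullTable_prepend, Equiv.swap_apply_right]
  have hc : IsClosed (cylinder w.1) := (isCompact_range (continuous_prepend w.1)).isClosed
  refine isTransposition_of_involutive (A := cylinder w.1) ⟨hc, isOpen_cylinder _⟩ ?_ ?_ ?_
  · rw [disjoint_left]
    rintro _ ⟨_, ⟨ξ, rfl⟩, rfl⟩ ⟨ζ, hζ⟩
    rw [hw] at hζ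
    exact hwv (Subtype.ext (prepend_inj (by rw [w.2, v.2]) hζ).1)
  · rintro _ ⟨ξ, rfl⟩
    rw [hw, hv, ← actInf_mul, h, actInf_one]
  · intro ξ h2 h3
    have e := prepend_take_drop n ξ
    have hw' : take n ξ ≠ w := fun h => h2 ⟨_, by rw [← h]; exact e⟩
    -- A point with prefix `v` is the image of a point with prefix `w`, because `k w` is invertible.
    have hv' : take n ξ ≠ v := fun h => h3 ⟨prepend w.1 (S.actInf (k w)⁻¹ (drop n ξ)), ⟨_, rfl⟩, by
      rw [hw, actInf_actInf_inv, ← h, e]⟩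
    rw [← e, fullTable_prepend, h1 _ hw' hv', actInf_one, Equiv.swap_apply_of_ne_of_ne hw' hv']

theorem permHom_mem (σ : Equiv.Perm (List.Vector A n)) :
    S.permHom n σ ∈ transpositionSubgroup S.KernelGroupoid := by
  induction σ using Equiv.Perm.swap_induction_on with
  | one => rw [map_one]; exact one_mem _
  | swap_mul σ w v hwv hσ =>
    rw [map_mul]
    exact mul_mem (Subgroup.subset_closure
      (S.isTransposition_fullTable_swap hwv (mul_one 1) fun _ _ _ => rfl)) hσ

/-- Modulo transpositions a group element at `w` can be moved to `v`: the quotient is a product of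
two transpositions that exchange the same two cylinders. -/
theorem diagHom_mulSingle_div_mem {w v : List.Vector A n} (hwv : w ≠ v) (g : Γ) :
    S.diagHom n (Pi.mulSingle w g) * (S.diagHom n (Pi.mulSingle v g))⁻¹ ∈
      transpositionSubgroup S.KernelGroupoid := by
  -- The values are placed crosswise, since the plain swap acts first: a point in `Z(w)` goes to
  -- `Z(v)` and is brought back with the label `k v = g`.
  let k : List.Vector A n → Γ := Pi.mulSingle v g * Pi.mulSingle w g⁻¹
  have hkv : k v = g := by simp [k, Pi.mulSingle_eq_of_ne hwv.symm]
  have hkw : k w = g⁻¹ := by simp [k, Pi.mulSingle_eq_of_ne hwv]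
  have hk : ∀ u, u ≠ w → u ≠ v → k u = 1 := fun u h1 h2 => by
    simp [k, Pi.mulSingle_eq_of_ne h1, Pi.mulSingle_eq_of_ne h2]
  have e : S.diagHom n (Pi.mulSingle w g) * (S.diagHom n (Pi.mulSingle v g))⁻¹ =
      S.fullTable (Equiv.swap w v) k * S.fullTable (Equiv.swap w v) 1 := by
    rw [← map_inv, ← map_mul, fullTable_mul, Equiv.swap_mul_self]
    change S.fullTable 1 _ = _
    congr 1
    funext u
    rw [Pi.one_apply, mul_one, Pi.mul_apply, Pi.inv_apply]
    by_cases h1 : u = w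
    · subst h1
      rw [Equiv.swap_apply_left, hkv, Pi.mulSingle_eq_same, Pi.mulSingle_eq_of_ne hwv, inv_one,
        mul_one]
    by_cases h2 : u = v
    · subst h2
      rw [Equiv.swap_apply_right, hkw, Pi.mulSingle_eq_same, Pi.mulSingle_eq_of_ne h1, one_mul]
    rw [Equiv.swap_apply_of_ne_of_ne h1 h2, hk u h1 h2, Pi.mulSingle_eq_of_ne h1,
      Pi.mulSingle_eq_of_ne h2, inv_one, mul_one]
  rw [e]
  exact mul_mem
    (Subgroup.subset_closure (S.isTransposition_fullTable_swap hwv (by rw [hkv, hkw,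
      mul_inv_cancel]) hk))
    (Subgroup.subset_closure (S.isTransposition_fullTable_swap hwv (mul_one 1) fun _ _ _ => rfl))

end Swap

end SelfSimilarGroup

/-! ### The parity homomorphism and its compatibility with restriction. -/

namespace InfiniteDihedral

theorem letter_restrict_a (x : Bool) :
    selfSimilar.letter a x = !x ∧ selfSimilar.restrict a x = 1 :=
  selfSimilar.letter_restrict_unique fun w => by
    change actHom a (x :: w) = (!x) :: actHom 1 w
    rw [actHom_a, map_one]
    cases x <;> rfl

theorem letter_restrict_b (x : Bool) :
    selfSimilar.letter b x = x ∧ selfSimilar.restrict b x = if x then b else a :=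
  selfSimilar.letter_restrict_unique fun w => by
    change actHom b (x :: w) = x :: actHom _ w
    cases x
    · exact (actHom_b _).trans (congrArg _ (actHom_a w).symm)
    · exact (actHom_b _).trans (congrArg _ (actHom_b w).symm)

/-- The values of the parity homomorphism on the generators. -/
def parityGen : DihedralGen → Multiplicative (ZMod 2)
  | .a => 1
  | .b => Multiplicative.ofAdd 1

theorem parityGen_rel : ∀ r ∈ range fun x : DihedralGen => FreeGroup.of x * FreeGroup.of x,
    FreeGroup.lift parityGen r = 1 := by
  rintro _ ⟨x, rfl⟩
  change FreeGroup.lift parityGen (FreeGroup.of x * FreeGroup.of x) = 1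
  rw [map_mul, FreeGroup.lift_apply_of]
  cases x <;> decide

/-- The homomorphism to `ℤ/2` with `a ↦ 0` and `b ↦ 1`. -/
def parity : InfiniteDihedral →* Multiplicative (ZMod 2) := PresentedGroup.toGroup parityGen_rel

theorem parity_a : parity a = 1 := by
  rw [parity, a, PresentedGroup.toGroup.of]; rfl

theorem parity_b : parity b = Multiplicative.ofAdd 1 := by
  rw [parity, b, PresentedGroup.toGroup.of]; rfl

/-- The homomorphism `γ ↦ ∑ₓ parity(γ|ₓ)`. -/
noncomputable def parityTransfer : InfiniteDihedral →* Multiplicative (ZMod 2) :=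
  MonoidHom.mk' (fun γ => ∏ x, parity (selfSimilar.restrict γ x)) fun γ η => by
    have hinj : Function.Injective (selfSimilar.letter η) := fun x y h => by
      have e : ∀ z, selfSimilar.letter η⁻¹ (selfSimilar.letter η z) = z := fun z => by
        rw [← (selfSimilar.letter_restrict_mul _ _ _).1, inv_mul_cancel,
          (selfSimilar.letter_restrict_one z).1]
      rw [← e x, h, e y]
    have hb := Finite.injective_iff_bijective.1 hinj
    -- The restriction of `γ η` at `x` is `γ|_{η · x} η|ₓ`, and `x ↦ η · x` permutes the letters, so
    -- the factors from `γ` can be reindexed.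
    rw [← hb.prod_comp fun x => parity (selfSimilar.restrict γ x), ← Finset.prod_mul_distrib]
    exact Finset.prod_congr rfl fun x _ => by
      rw [(selfSimilar.letter_restrict_mul _ _ _).2, map_mul]

/-- Both sides are homomorphisms, so the generators suffice: `a` has trivial restrictions, which
forces the value `0` on `a`, and `b` restricts to `a` and `b`, which leaves its value free. -/
theorem parity_eq_parityTransfer : parity = parityTransfer := by
  refine PresentedGroup.ext fun x => ?_
  cases x
  · change parity a = ∏ x, parity (selfSimilar.restrict a x)
    simp only [letter_restrict_a, parity_a, map_one, Finset.prod_const_one]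
  · change parity b = ∏ x, parity (selfSimilar.restrict b x)
    simp [letter_restrict_b, parity_a]

/-! ### Generation of the full group by `fullB` and the transpositions. -/

open SelfSimilarGroup

variable {n : ℕ}

/-- The generator `a` changes only the first letter, so placed at `w` it is the swap of the words
`w0` and `w1`. -/
theorem diagHom_a_mem (w : List.Vector Bool n) :
    selfSimilar.diagHom n (Pi.mulSingle w a) ∈ transpositionSubgroup selfSimilar.KernelGroupoid := by
  have e : selfSimilar.diagHom n (Pi.mulSingle w a) =
      selfSimilar.permHom (n + 1) (Equiv.swap (snoc w false) (snoc w true)) := by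
    refine selfSimilar.fullGroup_ext n fun u x ξ => ?_
    change (selfSimilar.fullTable 1 _).1 _ = (selfSimilar.fullTable _ 1).1 _
    rw [fullTable_prepend, ← prepend_snoc, fullTable_prepend, Pi.one_apply, actInf_one]
    by_cases h : u = w
    · subst h
      rw [Pi.mulSingle_eq_same, actInf_cons, (letter_restrict_a x).1, (letter_restrict_a x).2,
        actInf_one, Equiv.Perm.one_apply, ← prepend_snoc]
      cases x
      · rw [Equiv.swap_apply_left]; rfl
      · rw [Equiv.swap_apply_right]; rfl
    · rw [Pi.mulSingle_eq_of_ne h, actInf_one, Equiv.Perm.one_apply, ← prepend_snoc,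
        Equiv.swap_apply_of_ne_of_ne] <;> exact fun h' => h (snoc_inj.1 h').1
  rw [e]
  exact selfSimilar.permHom_mem _

/-- The recursion for `b` one level deeper; with `a` killed modulo transpositions, it pushes `b`
from `w` to `w1`. -/
theorem diagHom_b_eq (w : List.Vector Bool n) :
    selfSimilar.diagHom n (Pi.mulSingle w b) =
      selfSimilar.diagHom (n + 1) (Pi.mulSingle (snoc w false) a) *
        selfSimilar.diagHom (n + 1) (Pi.mulSingle (snoc w true) b) := by
  rw [← map_mul]
  refine selfSimilar.fullGroup_ext n fun u x ξ => ?_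
  change (selfSimilar.fullTable 1 _).1 _ = (selfSimilar.fullTable 1 _).1 _
  rw [fullTable_prepend, ← prepend_snoc, fullTable_prepend, Equiv.Perm.one_apply,
    Equiv.Perm.one_apply, prepend_snoc, Pi.mul_apply]
  by_cases h : u = w
  · subst h
    rw [Pi.mulSingle_eq_same, actInf_cons, (letter_restrict_b x).1, (letter_restrict_b x).2]
    cases x
    · rw [Pi.mulSingle_eq_same, Pi.mulSingle_eq_of_ne (by simp [snoc_inj]), mul_one]; rfl
    · rw [Pi.mulSingle_eq_same, Pi.mulSingle_eq_of_ne (by simp [snoc_inj]), one_mul]; rfl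
  · rw [Pi.mulSingle_eq_of_ne h, Pi.mulSingle_eq_of_ne (by simp [snoc_inj, h]),
      Pi.mulSingle_eq_of_ne (by simp [snoc_inj, h]), mul_one, actInf_one, actInf_one]

/-- The generator `b` as an element of the full group. -/
noncomputable def fullB : FullGroup selfSimilar.KernelGroupoid :=
  selfSimilar.diagHom 0 (Pi.mulSingle List.Vector.nil b)

theorem fullB_mul_fullB : fullB * fullB = 1 := by
  rw [fullB, ← map_mul, ← Pi.mulSingle_mul, b_mul_b, Pi.mulSingle_one, map_one]

theorem indexMap_fullB_ne_one : indexMap selfSimilar.KernelGroupoid fullB ≠ 1 := by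
  -- At level zero the basic bisection of `b` is already full and is the bisection of `fullB`.
  let t : Triple InfiniteDihedral Bool 0 := (List.Vector.nil, b, List.Vector.nil)
  have hu : cylinder ([] : List Bool) = univ := eq_univ_of_forall fun ξ => ⟨ξ, rfl⟩
  have hf : IsFullBisection (selfSimilar.basic t) :=
    ⟨selfSimilar.isBisection_basic t, (selfSimilar.image_s_basic t).trans hu,
      (selfSimilar.image_r_basic t).trans hu⟩
  have hp : IsPi (selfSimilar.basic t) fullB.1 := by
    rintro _ ⟨ξ, rfl⟩
    rw [r_arrow, s_arrow]
    change (selfSimilar.fullTable 1 (Pi.mulSingle List.Vector.nil b)).1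
      (prepend (List.Vector.nil : List.Vector Bool 0).1 ξ) = _
    rw [fullTable_prepend, Pi.mulSingle_eq_same]
    rfl
  intro h
  rw [indexMap_eq _ _ hf hp] at h
  have := selfSimilar.eq_zero_of_homClass_eq_zero isPseudoFree
    (ψ := fun γ => (parity γ).toAdd)
    (fun γ => by
      rw [← toAdd_prod]
      exact congrArg (fun q => Multiplicative.toAdd (q γ)) parity_eq_parityTransfer)
    (fun g h => by rw [map_mul, toAdd_mul]) t hf (ofAdd_eq_one.1 h)
  change (parity b).toAdd = 0 at this
  rw [parity_b, toAdd_ofAdd] at this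
  exact one_ne_zero this

theorem diagHom_b_mem (w : List.Vector Bool n) :
    selfSimilar.diagHom n (Pi.mulSingle w b) ∈
      Subgroup.zpowers fullB ⊔ transpositionSubgroup selfSimilar.KernelGroupoid := by
  induction n with
  | zero =>
    obtain rfl : w = List.Vector.nil := w.eq_nil
    exact Subgroup.mem_sup_left (Subgroup.mem_zpowers _)
  | succ n ih =>
    -- Any word of length `n` would serve. The recursion at `v` handles the single word `v1`, and
    -- every other word of length `n + 1` is reached by moving `b` there.
    let v : List.Vector Bool n := List.Vector.replicate n true
    have h1 := ih v
    rw [diagHom_b_eq] at h1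
    have h2 := (Subgroup.mul_mem_cancel_left _
      (Subgroup.mem_sup_right (diagHom_a_mem (snoc v false)))).1 h1
    by_cases hw : w = snoc v true
    · rwa [hw]
    · have h3 := mul_mem (Subgroup.mem_sup_right (selfSimilar.diagHom_mulSingle_div_mem hw b)) h2
      rwa [inv_mul_cancel_right] at h3

theorem zpowers_sup_transpositionSubgroup :
    Subgroup.zpowers fullB ⊔ transpositionSubgroup selfSimilar.KernelGroupoid = ⊤ := by
  refine eq_top_iff.2 fun h _ => ?_
  obtain ⟨n, σ, g, rfl⟩ := selfSimilar.exists_eq_fullTable h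
  rw [fullTable_eq_mul]
  refine mul_mem (Subgroup.mem_sup_right (selfSimilar.permHom_mem σ)) ?_
  -- The preimage under `diagHom` is a subgroup of a finite product of copies of the group, so
  -- families supported at one word suffice. There the generators can be treated one at a time.
  rw [← Subgroup.mem_comap]
  refine Subgroup.pi_mem_of_mulSingle_mem g fun w => ?_
  rw [Subgroup.mem_comap]
  induction g w using induction with
  | h1 => rw [Pi.mulSingle_one, map_one]; exact one_mem _
  | ha => exact Subgroup.mem_sup_right (diagHom_a_mem w)
  | hb => exact diagHom_b_mem w
  | hmul x y hx hy => rw [Pi.mulSingle_mul, map_mul]; exact mul_mem hx hy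
  | hinv x hx => rw [Pi.mulSingle_inv, map_inv]; exact inv_mem hx

end InfiniteDihedral

end TRGroupoid

/-! ### The kernel of the index map. -/

theorem mainTheorem9 :
    TRGroupoid.PropertyTR TRGroupoid.InfiniteDihedral.selfSimilar.KernelGroupoid := by
  open TRGroupoid InfiniteDihedral in
  refine le_antisymm transpositionSubgroup_le_ker fun h hh => ?_
  have hm : h ∈ ((Subgroup.zpowers fullB ⊔ transpositionSubgroup selfSimilar.KernelGroupoid :
      Subgroup (FullGroup selfSimilar.KernelGroupoid)) : Set _) := by
    rw [zpowers_sup_transpositionSubgroup]; trivial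
  -- Normality turns the join into a product set, so `h` is `fullB ^ k * t` with `t` generated by
  -- transpositions.
  rw [Subgroup.mul_normal] at hm
  obtain ⟨_, ⟨k, rfl⟩, t, ht, rfl⟩ := hm
  have h2 : fullB ^ (2 : ℤ) = 1 := (zpow_two _).trans fullB_mul_fullB
  change fullB ^ k * t ∈ _ at hh
  change fullB ^ k * t ∈ _
  -- For even `k` the power of the involution is trivial and `h = t`. For odd `k` the index of `h`
  -- would be that of `fullB`, which is nontrivial.
  obtain ⟨m, rfl | rfl⟩ := Int.even_or_odd' k
  · rwa [zpow_mul, h2, one_zpow, one_mul]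
  · rw [zpow_add, zpow_mul, h2, one_zpow, one_mul, zpow_one, MonoidHom.mem_ker, map_mul,
      MonoidHom.mem_ker.1 (transpositionSubgroup_le_ker ht), mul_one] at hh
    exact absurd hh indexMap_fullB_ne_one
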